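/- Let $V_4\mathbb{R}^6\cong SO(6)/SO(2)$ be the Stiefel manifold of orthonormal $4$-frames in $\mathbb{R}^6$, with $SO(2)$ embedded as the lower right $2\times 2$ block, base point $o=(e_1,e_2,e_3,e_4)$, $B(X,Y)=-4\operatorname{tr}(XY)$ the negative of the Killing form of $\mathfrak{so}(6)$, and $\mathfrak{m}=\mathfrak{so}(2)^{\perp}=\mathfrak{so}(3)\oplus\mathfrak{m}_{12}\oplus\mathfrak{m}_{13}\oplus\mathfrak{m}_{23}\cong T_o V_4\mathbb{R}^6$, where, with $\xi_{ab}=E_{ab}-E_{ba}$, the summands are spanned by the $\xi_{ab}$ with, respectively, $2\le a<b\le 4$; $a=1,\ 2\le b\le 4$; $a=1,\ b\in\{5,6\}$; $2\le a\le 4,\ b\in\{5,6\}$. Write $X=\sum a_{kl}\xi_{kl}\in\mathfrak{m}$ (sum over $k<l$, $k\le 4$); $X_{\mathfrak{so}(3)}$, $X_{\mathfrak{m}_{ij}}$ are its components and $[\cdot,\cdot]_{\mathfrak m}$ is the $\mathfrak{m}$-component of the bracket. For $\lambda_2>0$ let $\Lambda=(\lambda_2,\lambda_2,1,1)$ denote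 the $SO(6)$-invariant metric given on $\mathfrak{m}$ by $\langle X,Y\rangle=B(\Lambda X,Y)$, where $\Lambda$ is $\lambda_2\,\mathrm{Id}$ on $\mathfrak{so}(3)\oplus\mathfrak{m}_{12}$ and the identity on $\mathfrak{m}_{13}\oplus\mathfrak{m}_{23}$. **(a)** The metric $(\lambda_2,\lambda_2,1,1)$ is Einstein if and only if $\lambda_2=\frac{4\pm\sqrt 6}{5}$. (These are Jensen's Einstein metrics.) **(b)** Let $\Lambda=(\lambda_2,\lambda_2,1,1)$ be a Jensen Einstein metric and $X\in\mathfrak{m}$. Then the following are equivalent: (i) the curve $t\mapsto \exp(tX)\cdot o$ is a geodesic of $\Lambda$; (ii) $[X,\Lambda X]_{\mathfrak m}=0$; (iii) $[X_{\mathfrak{m}_{23}},X_{\mathfrak{so}(3)}]_{\mathfrak m}+[X_{\mathfrak{m}_{13}},X_{\mathfrak{m}_{12}}]_{\mathfrak m}=0$ and $[X_{\mathfrak{m}_{23}},X_{\mathfrak{m}_{12}}]_{\mathfrak m}=0$; (iv) the coefficients of $X$ satisfy $$\begin{array}{ll} a_{15}a_{12}-a_{45}a_{24}-a_{35}a_{23}=0,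 & a_{16}a_{12}-a_{46}a_{24}-a_{36}a_{23}=0,\\ a_{25}a_{23}-a_{45}a_{34}+a_{15}a_{13}=0, & a_{26}a_{23}-a_{46}a_{34}+a_{16}a_{13}=0,\\ a_{25}a_{24}+a_{35}a_{34}+a_{15}a_{14}=0, & a_{26}a_{24}+a_{36}a_{34}+a_{16}a_{14}=0,\\ a_{25}a_{12}+a_{35}a_{13}+a_{45}a_{14}=0, & a_{26}a_{12}+a_{36}a_{13}+a_{46}a_{14}=0; \end{array}$$ (v) the coefficients of $X$ belong to at least one of the $42$ families listed below. **(c)** Call a nonzero $X\in\mathfrak{m}$ a Jensen Einstein equigeodesic vector if $t\mapsto\exp(tX)\cdot o$ is a geodesic of every Einstein metric of the form $(\lambda_2,\lambda_2,1,1)$, $\lambda_2>0$. These vectors are exactly the nonzero $X\in\mathfrak m$ whose coefficients belong to one of the $42$ families. The $42$ families are pairwise distinct as sets (but not disjoint). The families (in each, the coefficients not determined by the listed equations are free real parameters): 1. $\{a_{12}=\frac{-a_{14} a_{23} + a_{13} a_{24}}{a_{34}},\ a_{35}=\frac{-a_{14} a_{15} - a_{24} a_{25}}{a_{34}},\ a_{36}=\frac{-a_{14}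 a_{16} - a_{24} a_{26}}{a_{34}},\ a_{45}=\frac{a_{13} a_{15} + a_{23} a_{25}}{a_{34}},\ a_{46}=\frac{a_{13} a_{16} + a_{23} a_{26}}{a_{34}},\ a_{34}\neq 0\}$ 2. $\{a_{12}=0,\ a_{13}=\frac{a_{14} a_{23}}{a_{24}},\ a_{35}=\frac{-a_{14} a_{15} - a_{24} a_{25}}{a_{34}},\ a_{36}=\frac{-a_{14} a_{16} - a_{24} a_{26}}{a_{34}},\ a_{45}=\frac{a_{23} (a_{14} a_{15} + a_{24} a_{25})}{a_{24} a_{34}},\ a_{46}=\frac{a_{23} (a_{14} a_{16} + a_{24} a_{26})}{a_{24} a_{34}},\ a_{24}\neq 0,\ a_{34}\neq 0\}$ 3. $\{a_{14}=0,\ a_{12}=\frac{a_{13} a_{24}}{a_{34}},\ a_{35}=\frac{-a_{24} a_{25}}{a_{34}},\ a_{36}=\frac{-a_{24} a_{26}}{a_{34}},\ a_{45}=\frac{a_{13} a_{15} + a_{23} a_{25}}{a_{34}},\ a_{46}=\frac{a_{13} a_{16} + a_{23} a_{26}}{a_{34}},\ a_{34}\neq 0\}$ 4. $\{a_{34}=0,\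 a_{13}=\frac{a_{14} a_{23}}{a_{24}},\ a_{25}=\frac{-a_{14} a_{15}}{a_{24}},\ a_{26}=\frac{-a_{14} a_{16}}{a_{24}},\ a_{45}=\frac{a_{12} a_{15} - a_{23} a_{35}}{a_{24}},\ a_{46}=\frac{a_{12} a_{16} - a_{23} a_{36}}{a_{24}},\ a_{24}\neq 0\}$ 5. $\{a_{12}=a_{35}=a_{45}=0,\ a_{13}=\frac{a_{14} a_{23}}{a_{24}},\ a_{25}=\frac{-a_{14} a_{15}}{a_{24}},\ a_{36}=\frac{-a_{14} a_{16} - a_{24} a_{26}}{a_{34}},\ a_{46}=\frac{a_{23} (a_{14} a_{16} + a_{24} a_{26})}{a_{24} a_{34}},\ a_{24}\neq 0,\ a_{34}\neq 0\}$ 6. $\{a_{12}=a_{13}=a_{14}=0,\ a_{35}=\frac{-a_{24} a_{25}}{a_{34}},\ a_{36}=\frac{-a_{24} a_{26}}{a_{34}},\ a_{45}=\frac{a_{23} a_{25}}{a_{34}},\ a_{46}=\frac{a_{23} a_{26}}{a_{34}},\ a_{34}\neq 0\}$ 7. $\{a_{12}=a_{13}=a_{23}=a_{45}=a_{46}=0,\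 a_{35}=\frac{-a_{14} a_{15} - a_{24} a_{25}}{a_{34}},\ a_{36}=\frac{-a_{14} a_{16} - a_{24} a_{26}}{a_{34}},\ a_{34}\neq 0\}$ 8. $\{a_{12}=a_{14}=a_{24}=a_{35}=a_{36}=0,\ a_{45}=\frac{a_{13} a_{15} + a_{23} a_{25}}{a_{34}},\ a_{46}=\frac{a_{13} a_{16} + a_{23} a_{26}}{a_{34}},\ a_{34}\neq 0\}$ 9. $\{a_{12}=a_{23}=a_{24}=0,\ a_{35}=\frac{-a_{14} a_{15}}{a_{34}},\ a_{36}=\frac{-a_{14} a_{16}}{a_{34}},\ a_{45}=\frac{a_{13} a_{15}}{a_{34}},\ a_{46}=\frac{a_{13} a_{16}}{a_{34}},\ a_{34}\neq 0\}$ 10. $\{a_{12}=a_{34}=0,\ a_{13}=\frac{a_{14} a_{23}}{a_{24}},\ a_{25}=\frac{-a_{14} a_{15}}{a_{24}},\ a_{26}=\frac{-a_{14} a_{16}}{a_{24}},\ a_{45}=\frac{-a_{23} a_{35}}{a_{24}},\ a_{46}=\frac{-a_{23} a_{36}}{a_{24}},\ a_{24}\neq 0\}$ 11. $\{a_{15}=a_{34}=a_{25}=0,\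 a_{13}=\frac{a_{14} a_{23}}{a_{24}},\ a_{26}=\frac{-a_{14} a_{16}}{a_{24}},\ a_{45}=\frac{-a_{23} a_{35}}{a_{24}},\ a_{46}=\frac{a_{12} a_{16} - a_{23} a_{36}}{a_{24}},\ a_{24}\neq 0\}$ 12. $\{a_{13}=a_{14}=a_{34}=a_{25}=a_{26}=0,\ a_{45}=\frac{a_{12} a_{15} - a_{23} a_{35}}{a_{24}},\ a_{46}=\frac{a_{12} a_{16} - a_{23} a_{36}}{a_{24}},\ a_{24}\neq 0\}$ 13. $\{a_{13}=a_{23}=a_{34}=0,\ a_{25}=\frac{-a_{14} a_{15}}{a_{24}},\ a_{26}=\frac{-a_{14} a_{16}}{a_{24}},\ a_{45}=\frac{a_{12} a_{15}}{a_{24}},\ a_{46}=\frac{a_{12} a_{16}}{a_{24}},\ a_{24}\neq 0\}$ 14. $\{a_{14}=a_{24}=a_{34}=0,\ a_{25}=\frac{-a_{13} a_{15}}{a_{23}},\ a_{26}=\frac{-a_{13} a_{16}}{a_{23}},\ a_{35}=\frac{a_{12} a_{15}}{a_{23}},\ a_{36}=\frac{a_{12} a_{16}}{a_{23}},\ a_{23}\neq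 0\}$ 15. $\{a_{15}=a_{16}=a_{23}=a_{24}=a_{34}=0,\ a_{45}=\frac{-a_{12} a_{25} - a_{13} a_{35}}{a_{14}},\ a_{46}=\frac{-a_{12} a_{26} - a_{13} a_{36}}{a_{14}},\ a_{14}\neq 0\}$ 16. $\{a_{12}=a_{13}=a_{14}=a_{25}=a_{35}=a_{45}=0,\ a_{36}=\frac{-a_{24} a_{26}}{a_{34}},\ a_{46}=\frac{a_{23} a_{26}}{a_{34}},\ a_{34}\neq 0\}$ 17. $\{a_{12}=a_{13}=a_{23}=a_{35}=a_{45}=a_{46}=0,\ a_{25}=\frac{-a_{14} a_{15}}{a_{24}},\ a_{36}=\frac{-a_{14} a_{16} - a_{24} a_{26}}{a_{34}},\ a_{24}\neq 0,\ a_{34}\neq 0\}$ 18. $\{a_{12}=a_{14}=a_{24}=a_{35}=a_{36}=a_{45}=0,\ a_{25}=\frac{-a_{13} a_{15}}{a_{23}},\ a_{46}=\frac{a_{13} a_{16} + a_{23} a_{26}}{a_{34}},\ a_{23}\neq 0,\ a_{34}\neq 0\}$ 19. $\{a_{12}=a_{15}=a_{23}=a_{24}=a_{35}=a_{45}=0,\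 a_{36}=\frac{-a_{14} a_{16}}{a_{34}},\ a_{46}=\frac{a_{13} a_{16}}{a_{34}},\ a_{34}\neq 0\}$ 20. $\{a_{12}=a_{15}=a_{34}=a_{25}=0,\ a_{13}=\frac{a_{14} a_{23}}{a_{24}},\ a_{26}=\frac{-a_{14} a_{16}}{a_{24}},\ a_{45}=\frac{-a_{23} a_{35}}{a_{24}},\ a_{46}=\frac{-a_{23} a_{36}}{a_{24}},\ a_{24}\neq 0\}$ 21. $\{a_{12}=a_{13}=a_{14}=a_{34}=a_{25}=a_{26}=0,\ a_{45}=\frac{-a_{23} a_{35}}{a_{24}},\ a_{46}=\frac{-a_{23} a_{36}}{a_{24}},\ a_{24}\neq 0\}$ 22. $\{a_{13}=a_{14}=a_{15}=a_{34}=a_{25}=a_{26}=0,\ a_{45}=\frac{-a_{23} a_{35}}{a_{24}},\ a_{46}=\frac{a_{12} a_{16} - a_{23} a_{36}}{a_{24}},\ a_{24}\neq 0\}$ 23. $\{a_{13}=a_{14}=a_{23}=a_{34}=a_{25}=a_{26}=0,\ a_{45}=\frac{a_{12} a_{15}}{a_{24}},\ a_{46}=\frac{a_{12} a_{16}}{a_{24}},\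 a_{24}\neq 0\}$ 24. $\{a_{13}=a_{15}=a_{23}=a_{34}=a_{25}=a_{45}=0,\ a_{26}=\frac{-a_{14} a_{16}}{a_{24}},\ a_{46}=\frac{a_{12} a_{16}}{a_{24}},\ a_{24}\neq 0\}$ 25. $\{a_{12}=a_{14}=a_{24}=a_{34}=a_{35}=a_{36}=0,\ a_{25}=\frac{-a_{13} a_{15}}{a_{23}},\ a_{26}=\frac{-a_{13} a_{16}}{a_{23}},\ a_{23}\neq 0\}$ 26. $\{a_{13}=a_{14}=a_{24}=a_{34}=a_{25}=a_{26}=0,\ a_{35}=\frac{a_{12} a_{15}}{a_{23}},\ a_{36}=\frac{a_{12} a_{16}}{a_{23}},\ a_{23}\neq 0\}$ 27. $\{a_{14}=a_{15}=a_{24}=a_{34}=a_{25}=a_{35}=0,\ a_{26}=\frac{-a_{13} a_{16}}{a_{23}},\ a_{36}=\frac{a_{12} a_{16}}{a_{23}},\ a_{23}\neq 0\}$ 28. $\{a_{14}=a_{15}=a_{16}=a_{23}=a_{24}=a_{34}=0,\ a_{35}=\frac{-a_{12} a_{25}}{a_{13}},\ a_{36}=\frac{-a_{12} a_{26}}{a_{13}},\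 a_{13}\neq 0\}$ 29. $\{a_{15}=a_{16}=a_{25}=a_{26}=a_{35}=a_{36}=a_{45}=a_{46}=0,\ a_{13}=\frac{a_{14} a_{23}}{a_{24}},\ a_{24}\neq 0\}$ 30. $\{a_{12}=a_{14}=a_{15}=a_{23}=a_{24}=a_{35}=a_{36}=a_{45}=0,\ a_{46}=\frac{a_{13} a_{16}}{a_{34}},\ a_{34}\neq 0\}$ 31. $\{a_{12}=a_{13}=a_{14}=a_{15}=a_{34}=a_{25}=a_{26}=0,\ a_{45}=\frac{-a_{23} a_{35}}{a_{24}},\ a_{46}=\frac{-a_{23} a_{36}}{a_{24}},\ a_{24}\neq 0\}$ 32. $\{a_{13}=a_{14}=a_{15}=a_{23}=a_{34}=a_{25}=a_{26}=a_{45}=0,\ a_{46}=\frac{a_{12} a_{16}}{a_{24}},\ a_{24}\neq 0\}$ 33. $\{a_{12}=a_{14}=a_{15}=a_{24}=a_{34}=a_{25}=a_{35}=a_{36}=0,\ a_{26}=\frac{-a_{13} a_{16}}{a_{23}},\ a_{23}\neq 0\}$ 34. $\{a_{13}=a_{14}=a_{15}=a_{24}=a_{34}=a_{25}=a_{26}=a_{35}=0,\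 a_{36}=\frac{a_{12} a_{16}}{a_{23}},\ a_{23}\neq 0\}$ 35. $\{a_{12}=a_{14}=a_{15}=a_{16}=a_{23}=a_{24}=a_{34}=a_{35}=a_{36}=0\}$ 36. $\{a_{13}=a_{14}=a_{15}=a_{16}=a_{23}=a_{24}=a_{34}=a_{25}=a_{26}=0\}$ 37. $\{a_{14}=a_{15}=a_{16}=a_{24}=a_{25}=a_{26}=a_{35}=a_{36}=a_{45}=a_{46}=0\}$ 38. $\{a_{15}=a_{16}=a_{23}=a_{24}=a_{25}=a_{26}=a_{35}=a_{36}=a_{45}=a_{46}=0\}$ 39. $\{a_{12}=a_{13}=a_{14}=a_{23}=a_{24}=a_{35}=a_{36}=a_{45}=a_{46}=0\}$ 40. $\{a_{14}=a_{15}=a_{16}=a_{25}=a_{26}=a_{35}=a_{36}=a_{45}=a_{46}=0\}$ 41. $\{a_{15}=a_{16}=a_{25}=a_{26}=a_{35}=a_{36}=a_{45}=a_{46}=0\}$ 42. $\{a_{12}=a_{13}=a_{14}=a_{23}=a_{24}=a_{34}=0\}$ -/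

import Mathlib

open scoped ContDiff Matrix

noncomputable section

namespace StiefelV4R6

/-! The Stiefel manifold of orthonormal 4-frames in ℝ⁶, as the homogeneous space `SO(6)/SO(2)`.
The indices `1, …, 6` of the usual notation are `0, …, 5` here. -/

/-- The negative of the Killing form of `so(6)`: `B(X, Y) = -(6 - 2) tr(XY)`. -/
def B (X Y : Matrix (Fin 6) (Fin 6) ℝ) : ℝ := -4 * (X * Y).trace

/-- The isotropy algebra `so(2)`, embedded as the lower right `2 × 2` block. -/
def hSpace : Set (Matrix (Fin 6) (Fin 6) ℝ) :=
  {X | X ∈ LieAlgebra.Orthogonal.so (Fin 6) ℝ ∧ ∀ i j : Fin 6, (i < 4 ∨ j < 4) → X i j = 0}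

/-- The reductive complement `m`: the `B`-orthogonal complement of `so(2)` in `so(6)`. -/
def mSpace : Set (Matrix (Fin 6) (Fin 6) ℝ) :=
  {X | X ∈ LieAlgebra.Orthogonal.so (Fin 6) ℝ ∧ ∀ Y ∈ hSpace, B X Y = 0}

/-- The partition `6 = 1 + 3 + 2` of the indices. -/
def blk : Fin 6 → Fin 3 := ![0, 1, 1, 1, 2, 2]

/-- The component of a skew matrix in the blocks `(p, q)` and `(q, p)` of the partition `1 + 3 + 2`.
On `so(6)`: `part 1 1` is the `so(3)`-component, `part 0 1`, `part 0 2`, `part 1 2` are the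
components in `m₁₂`, `m₁₃`, `m₂₃`, and `part 2 2` is the component in the isotropy algebra. -/
def part (p q : Fin 3) (X : Matrix (Fin 6) (Fin 6) ℝ) : Matrix (Fin 6) (Fin 6) ℝ :=
  Matrix.of fun i j =>
    if (blk i = p ∧ blk j = q) ∨ (blk i = q ∧ blk j = p) then X i j else 0

/-- The projection of `so(6)` onto the isotropy algebra along `m`. -/
def projH (X : Matrix (Fin 6) (Fin 6) ℝ) : Matrix (Fin 6) (Fin 6) ℝ := part 2 2 X

/-- The projection of `so(6)` onto `m`. -/
def projM (X : Matrix (Fin 6) (Fin 6) ℝ) : Matrix (Fin 6) (Fin 6) ℝ := X - projH X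

/-- The operator `Λ = x₂ Id_{so(3)} + x₁₂ Id_{m₁₂} + x₁₃ Id_{m₁₃} + x₂₃ Id_{m₂₃}`. -/
def metricOp (x₂ x₁₂ x₁₃ x₂₃ : ℝ) (X : Matrix (Fin 6) (Fin 6) ℝ) : Matrix (Fin 6) (Fin 6) ℝ :=
  x₂ • part 1 1 X + x₁₂ • part 0 1 X + x₁₃ • part 0 2 X + x₂₃ • part 1 2 X

/-- The operator `Λ = (x, x, 1, 1)` of a Jensen metric. -/
def jensenOp (x : ℝ) (X : Matrix (Fin 6) (Fin 6) ℝ) : Matrix (Fin 6) (Fin 6) ℝ :=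
  metricOp x x 1 1 X

/-- The inverse of `jensenOp x` on `m` (for `x ≠ 0`). -/
def jensenOpInv (x : ℝ) (X : Matrix (Fin 6) (Fin 6) ℝ) : Matrix (Fin 6) (Fin 6) ℝ :=
  metricOp x⁻¹ x⁻¹ 1 1 X

/-- The `Ad(SO(2))`-invariant inner product `⟨X, Y⟩ = B(ΛX, Y)` on `m`. -/
def innerM (x : ℝ) (X Y : Matrix (Fin 6) (Fin 6) ℝ) : ℝ := B (jensenOp x X) Y

/-! ### The Einstein condition -/

/-- The Levi-Civita connection of the invariant metric at the origin (the Nomizu map)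
`∇_X Y = ½ [X, Y]_m + U(X, Y)` on `m`, where
`2 ⟨U(X, Y), Z⟩ = ⟨[Z, X]_m, Y⟩ + ⟨X, [Z, Y]_m⟩` for all `Z ∈ m`,
that is `U(X, Y) = ½ Λ⁻¹ ([X, ΛY] + [Y, ΛX])_m`. -/
def nabla (x : ℝ) (X Y : Matrix (Fin 6) (Fin 6) ℝ) : Matrix (Fin 6) (Fin 6) ℝ :=
  (1 / 2 : ℝ) • projM ⁅X, Y⁆ +
    (1 / 2 : ℝ) • jensenOpInv x (projM (⁅X, jensenOp x Y⁆ + ⁅Y, jensenOp x X⁆))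

/-- The curvature tensor at the origin,
`R(X, Y)Z = ∇_X ∇_Y Z - ∇_Y ∇_X Z - ∇_{[X, Y]_m} Z - [[X, Y]_h, Z]`. -/
def curv (x : ℝ) (X Y Z : Matrix (Fin 6) (Fin 6) ℝ) : Matrix (Fin 6) (Fin 6) ℝ :=
  nabla x X (nabla x Y Z) - nabla x Y (nabla x X Z) - nabla x (projM ⁅X, Y⁆) Z
    - ⁅projH ⁅X, Y⁆, Z⁆

/-- `ξ_ab = E_ab - E_ba`. -/
def xi (a b : Fin 6) : Matrix (Fin 6) (Fin 6) ℝ := Matrix.single a b 1 - Matrix.single b a 1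

/-- The Ricci tensor at the origin, `Ric(Y, Z) = tr (X ↦ R(X, Y)Z)` on `m`. The trace is taken in
the basis `ξ_ab`, `a < b`, `a ≤ 4` (`a < 4` in indices starting at `0`) of `m`; the coefficient of
`ξ_ab` in a skew matrix is its `(a, b)` entry. -/
def ricci (x : ℝ) (Y Z : Matrix (Fin 6) (Fin 6) ℝ) : ℝ :=
  ∑ a : Fin 6, ∑ b : Fin 6, if a < b ∧ a < 4 then curv x (xi a b) Y Z a b else 0

/-- The metric `(x, x, 1, 1)` is Einstein: `Ric = c g`. By invariance this is a condition at the
origin. -/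
def IsEinstein (x : ℝ) : Prop :=
  ∃ c : ℝ, ∀ Y ∈ mSpace, ∀ Z ∈ mSpace, ricci x Y Z = c * innerM x Y Z

/-! ### The Riemannian manifold and its geodesics -/

/-- The Stiefel manifold of orthonormal 4-frames in `ℝ⁶` (the columns of `p`). -/
def stiefel : Set (Matrix (Fin 6) (Fin 4) ℝ) := {p | pᵀ * p = 1}

/-- The origin: the frame `(e₁, e₂, e₃, e₄)`, whose stabilizer in `SO(6)` is `SO(2)`. -/
def origin : Matrix (Fin 6) (Fin 4) ℝ :=
  Matrix.of fun i j => if (i : ℕ) = (j : ℕ) then 1 else 0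

/-- The square `g_p(w, w)` of the length of a tangent vector `w` of the Stiefel manifold at `p`, for
the `SO(6)`-invariant metric that is `innerM x` at the origin (see `metricSq_smul`). Here `pᵀ w` is
the part of `w` tangential to the span of the frame. -/
def metricSq (x : ℝ) (p w : Matrix (Fin 6) (Fin 4) ℝ) : ℝ :=
  4 * (x * ∑ i, ∑ j, (pᵀ * w) i j ^ 2 +
    2 * (∑ i, ∑ j, w i j ^ 2 - ∑ i, ∑ j, (pᵀ * w) i j ^ 2))

/-- The velocity of a curve of matrices. -/
def velocity (c : ℝ → Matrix (Fin 6) (Fin 4) ℝ) (t : ℝ) : Matrix (Fin 6) (Fin 4) ℝ :=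
  Matrix.of fun i j => deriv (fun τ => c τ i j) t

/-- The energy of a curve on `[a, b]`. -/
def energy (x a b : ℝ) (c : ℝ → Matrix (Fin 6) (Fin 4) ℝ) : ℝ :=
  1 / 2 * ∫ t in a..b, metricSq x (c t) (velocity c t)

/-- A smooth variation of `γ` in the Stiefel manifold, with end points at `a` and `b` fixed. -/
def IsVariation (γ : ℝ → Matrix (Fin 6) (Fin 4) ℝ) (a b : ℝ)
    (F : ℝ → ℝ → Matrix (Fin 6) (Fin 4) ℝ) : Prop :=
  (∀ s t, F s t ∈ stiefel) ∧
  (∀ i j, ContDiff ℝ ∞ fun z : ℝ × ℝ => F z.1 z.2 i j) ∧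
  (∀ t, F 0 t = γ t) ∧
  ∀ s, F s a = γ a ∧ F s b = γ b

/-- A smooth curve in the Stiefel manifold is a (constant speed) geodesic of the metric
`(x, x, 1, 1)` if on each interval it is a critical point of the energy among the curves with the
same end points. -/
def IsGeodesic (x : ℝ) (γ : ℝ → Matrix (Fin 6) (Fin 4) ℝ) : Prop :=
  (∀ t, γ t ∈ stiefel) ∧
  (∀ i j, ContDiff ℝ ∞ fun t => γ t i j) ∧
  ∀ a b : ℝ, a < b → ∀ F, IsVariation γ a b F →
    HasDerivAt (fun s => energy x a b (F s)) 0 0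

/-- The orbit `t ↦ exp(tX) · o` of a one-parameter subgroup of `SO(6)`. -/
def orbit (X : Matrix (Fin 6) (Fin 6) ℝ) (t : ℝ) : Matrix (Fin 6) (Fin 4) ℝ :=
  NormedSpace.exp (t • X) * origin

/-- Jensen's Einstein equigeodesic vectors: the nonzero `X ∈ m` whose orbit `exp(tX) · o` is a
geodesic of every Einstein metric of the form `(x, x, 1, 1)`. -/
def IsJensenEquigeodesicVector (X : Matrix (Fin 6) (Fin 6) ℝ) : Prop :=
  X ∈ mSpace ∧ X ≠ 0 ∧ ∀ x : ℝ, 0 < x → IsEinstein x → IsGeodesic x (orbit X)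

/-! ### Coordinates, the system of equations and the list of its solutions -/

/-- The coefficients of a vector `∑ a_kl ξ_kl` of `m`. -/
structure Coeff where
  (a12 a13 a14 a15 a16 a23 a24 a25 a26 a34 a35 a36 a45 a46 : ℝ)

/-- The coefficients of `X ∈ m` in the basis `ξ_kl`. -/
def coeff (X : Matrix (Fin 6) (Fin 6) ℝ) : Coeff where
  a12 := X 0 1
  a13 := X 0 2
  a14 := X 0 3
  a15 := X 0 4
  a16 := X 0 5
  a23 := X 1 2
  a24 := X 1 3
  a25 := X 1 4
  a26 := X 1 5
  a34 := X 2 3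
  a35 := X 2 4
  a36 := X 2 5
  a45 := X 3 4
  a46 := X 3 5

/-- The system of eight bilinear equations. -/
def BilinearSystem (a : Coeff) : Prop :=
  a.a15 * a.a12 - a.a45 * a.a24 - a.a35 * a.a23 = 0 ∧
  a.a16 * a.a12 - a.a46 * a.a24 - a.a36 * a.a23 = 0 ∧
  a.a25 * a.a23 - a.a45 * a.a34 + a.a15 * a.a13 = 0 ∧
  a.a26 * a.a23 - a.a46 * a.a34 + a.a16 * a.a13 = 0 ∧
  a.a25 * a.a24 + a.a35 * a.a34 + a.a15 * a.a14 = 0 ∧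
  a.a26 * a.a24 + a.a36 * a.a34 + a.a16 * a.a14 = 0 ∧
  a.a25 * a.a12 + a.a35 * a.a13 + a.a45 * a.a14 = 0 ∧
  a.a26 * a.a12 + a.a36 * a.a13 + a.a46 * a.a14 = 0

/-- The 42 families of solutions. In each family the coefficients that stand alone on the left of an
equation are expressed through the others, which are free parameters, subject to the denominators
being different from `0`. -/
def family : Fin 42 → Set Coeff :=
  ![
    {a | a.a34 ≠ 0 ∧ a.a12 = (-a.a14 * a.a23 + a.a13 * a.a24) / a.a34 ∧
      a.a35 = (-a.a14 * a.a15 - a.a24 * a.a25) / a.a34 ∧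
      a.a36 = (-a.a14 * a.a16 - a.a24 * a.a26) / a.a34 ∧
      a.a45 = (a.a13 * a.a15 + a.a23 * a.a25) / a.a34 ∧
      a.a46 = (a.a13 * a.a16 + a.a23 * a.a26) / a.a34},
    {a | a.a24 ≠ 0 ∧ a.a34 ≠ 0 ∧ a.a12 = 0 ∧ a.a13 = (a.a14 * a.a23) / a.a24 ∧
      a.a35 = (-a.a14 * a.a15 - a.a24 * a.a25) / a.a34 ∧
      a.a36 = (-a.a14 * a.a16 - a.a24 * a.a26) / a.a34 ∧
      a.a45 = (a.a23 * (a.a14 * a.a15 + a.a24 * a.a25)) / (a.a24 * a.a34) ∧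
      a.a46 = (a.a23 * (a.a14 * a.a16 + a.a24 * a.a26)) / (a.a24 * a.a34)},
    {a | a.a34 ≠ 0 ∧ a.a12 = (a.a13 * a.a24) / a.a34 ∧ a.a14 = 0 ∧
      a.a35 = (-a.a24 * a.a25) / a.a34 ∧ a.a36 = (-a.a24 * a.a26) / a.a34 ∧
      a.a45 = (a.a13 * a.a15 + a.a23 * a.a25) / a.a34 ∧
      a.a46 = (a.a13 * a.a16 + a.a23 * a.a26) / a.a34},
    {a | a.a24 ≠ 0 ∧ a.a13 = (a.a14 * a.a23) / a.a24 ∧ a.a34 = 0 ∧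
      a.a25 = (-a.a14 * a.a15) / a.a24 ∧ a.a26 = (-a.a14 * a.a16) / a.a24 ∧
      a.a45 = (a.a12 * a.a15 - a.a23 * a.a35) / a.a24 ∧
      a.a46 = (a.a12 * a.a16 - a.a23 * a.a36) / a.a24},
    {a | a.a24 ≠ 0 ∧ a.a34 ≠ 0 ∧ a.a12 = 0 ∧ a.a13 = (a.a14 * a.a23) / a.a24 ∧
      a.a25 = (-a.a14 * a.a15) / a.a24 ∧ a.a35 = 0 ∧
      a.a36 = (-a.a14 * a.a16 - a.a24 * a.a26) / a.a34 ∧ a.a45 = 0 ∧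
      a.a46 = (a.a23 * (a.a14 * a.a16 + a.a24 * a.a26)) / (a.a24 * a.a34)},
    {a | a.a34 ≠ 0 ∧ a.a12 = 0 ∧ a.a13 = 0 ∧ a.a14 = 0 ∧ a.a35 = (-a.a24 * a.a25) / a.a34 ∧
      a.a36 = (-a.a24 * a.a26) / a.a34 ∧ a.a45 = (a.a23 * a.a25) / a.a34 ∧
      a.a46 = (a.a23 * a.a26) / a.a34},
    {a | a.a34 ≠ 0 ∧ a.a12 = 0 ∧ a.a13 = 0 ∧ a.a23 = 0 ∧
      a.a35 = (-a.a14 * a.a15 - a.a24 * a.a25) / a.a34 ∧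
      a.a36 = (-a.a14 * a.a16 - a.a24 * a.a26) / a.a34 ∧ a.a45 = 0 ∧ a.a46 = 0},
    {a | a.a34 ≠ 0 ∧ a.a12 = 0 ∧ a.a14 = 0 ∧ a.a24 = 0 ∧ a.a35 = 0 ∧ a.a36 = 0 ∧
      a.a45 = (a.a13 * a.a15 + a.a23 * a.a25) / a.a34 ∧
      a.a46 = (a.a13 * a.a16 + a.a23 * a.a26) / a.a34},
    {a | a.a34 ≠ 0 ∧ a.a12 = 0 ∧ a.a23 = 0 ∧ a.a24 = 0 ∧ a.a35 = (-a.a14 * a.a15) / a.a34 ∧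
      a.a36 = (-a.a14 * a.a16) / a.a34 ∧ a.a45 = (a.a13 * a.a15) / a.a34 ∧
      a.a46 = (a.a13 * a.a16) / a.a34},
    {a | a.a24 ≠ 0 ∧ a.a12 = 0 ∧ a.a13 = (a.a14 * a.a23) / a.a24 ∧ a.a34 = 0 ∧
      a.a25 = (-a.a14 * a.a15) / a.a24 ∧ a.a26 = (-a.a14 * a.a16) / a.a24 ∧
      a.a45 = (-a.a23 * a.a35) / a.a24 ∧ a.a46 = (-a.a23 * a.a36) / a.a24},
    {a | a.a24 ≠ 0 ∧ a.a13 = (a.a14 * a.a23) / a.a24 ∧ a.a15 = 0 ∧ a.a34 = 0 ∧ a.a25 = 0 ∧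
      a.a26 = (-a.a14 * a.a16) / a.a24 ∧ a.a45 = (-a.a23 * a.a35) / a.a24 ∧
      a.a46 = (a.a12 * a.a16 - a.a23 * a.a36) / a.a24},
    {a | a.a24 ≠ 0 ∧ a.a13 = 0 ∧ a.a14 = 0 ∧ a.a34 = 0 ∧ a.a25 = 0 ∧ a.a26 = 0 ∧
      a.a45 = (a.a12 * a.a15 - a.a23 * a.a35) / a.a24 ∧
      a.a46 = (a.a12 * a.a16 - a.a23 * a.a36) / a.a24},
    {a | a.a24 ≠ 0 ∧ a.a13 = 0 ∧ a.a23 = 0 ∧ a.a34 = 0 ∧ a.a25 = (-a.a14 * a.a15) / a.a24 ∧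
      a.a26 = (-a.a14 * a.a16) / a.a24 ∧ a.a45 = (a.a12 * a.a15) / a.a24 ∧
      a.a46 = (a.a12 * a.a16) / a.a24},
    {a | a.a23 ≠ 0 ∧ a.a14 = 0 ∧ a.a24 = 0 ∧ a.a34 = 0 ∧ a.a25 = (-a.a13 * a.a15) / a.a23 ∧
      a.a26 = (-a.a13 * a.a16) / a.a23 ∧ a.a35 = (a.a12 * a.a15) / a.a23 ∧
      a.a36 = (a.a12 * a.a16) / a.a23},
    {a | a.a14 ≠ 0 ∧ a.a15 = 0 ∧ a.a16 = 0 ∧ a.a23 = 0 ∧ a.a24 = 0 ∧ a.a34 = 0 ∧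
      a.a45 = (-a.a12 * a.a25 - a.a13 * a.a35) / a.a14 ∧
      a.a46 = (-a.a12 * a.a26 - a.a13 * a.a36) / a.a14},
    {a | a.a34 ≠ 0 ∧ a.a12 = 0 ∧ a.a13 = 0 ∧ a.a14 = 0 ∧ a.a25 = 0 ∧ a.a35 = 0 ∧
      a.a36 = (-a.a24 * a.a26) / a.a34 ∧ a.a45 = 0 ∧ a.a46 = (a.a23 * a.a26) / a.a34},
    {a | a.a24 ≠ 0 ∧ a.a34 ≠ 0 ∧ a.a12 = 0 ∧ a.a13 = 0 ∧ a.a23 = 0 ∧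
      a.a25 = (-a.a14 * a.a15) / a.a24 ∧ a.a35 = 0 ∧
      a.a36 = (-a.a14 * a.a16 - a.a24 * a.a26) / a.a34 ∧ a.a45 = 0 ∧ a.a46 = 0},
    {a | a.a23 ≠ 0 ∧ a.a34 ≠ 0 ∧ a.a12 = 0 ∧ a.a14 = 0 ∧ a.a24 = 0 ∧
      a.a25 = (-a.a13 * a.a15) / a.a23 ∧ a.a35 = 0 ∧ a.a36 = 0 ∧ a.a45 = 0 ∧
      a.a46 = (a.a13 * a.a16 + a.a23 * a.a26) / a.a34},
    {a | a.a34 ≠ 0 ∧ a.a12 = 0 ∧ a.a15 = 0 ∧ a.a23 = 0 ∧ a.a24 = 0 ∧ a.a35 = 0 ∧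
      a.a36 = (-a.a14 * a.a16) / a.a34 ∧ a.a45 = 0 ∧ a.a46 = (a.a13 * a.a16) / a.a34},
    {a | a.a24 ≠ 0 ∧ a.a12 = 0 ∧ a.a13 = (a.a14 * a.a23) / a.a24 ∧ a.a15 = 0 ∧ a.a34 = 0 ∧
      a.a25 = 0 ∧ a.a26 = (-a.a14 * a.a16) / a.a24 ∧ a.a45 = (-a.a23 * a.a35) / a.a24 ∧
      a.a46 = (-a.a23 * a.a36) / a.a24},
    {a | a.a24 ≠ 0 ∧ a.a12 = 0 ∧ a.a13 = 0 ∧ a.a14 = 0 ∧ a.a34 = 0 ∧ a.a25 = 0 ∧ a.a26 = 0 ∧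
      a.a45 = (-a.a23 * a.a35) / a.a24 ∧ a.a46 = (-a.a23 * a.a36) / a.a24},
    {a | a.a24 ≠ 0 ∧ a.a13 = 0 ∧ a.a14 = 0 ∧ a.a15 = 0 ∧ a.a34 = 0 ∧ a.a25 = 0 ∧ a.a26 = 0 ∧
      a.a45 = (-a.a23 * a.a35) / a.a24 ∧ a.a46 = (a.a12 * a.a16 - a.a23 * a.a36) / a.a24},
    {a | a.a24 ≠ 0 ∧ a.a13 = 0 ∧ a.a14 = 0 ∧ a.a23 = 0 ∧ a.a34 = 0 ∧ a.a25 = 0 ∧ a.a26 = 0 ∧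
      a.a45 = (a.a12 * a.a15) / a.a24 ∧ a.a46 = (a.a12 * a.a16) / a.a24},
    {a | a.a24 ≠ 0 ∧ a.a13 = 0 ∧ a.a15 = 0 ∧ a.a23 = 0 ∧ a.a34 = 0 ∧ a.a25 = 0 ∧
      a.a26 = (-a.a14 * a.a16) / a.a24 ∧ a.a45 = 0 ∧ a.a46 = (a.a12 * a.a16) / a.a24},
    {a | a.a23 ≠ 0 ∧ a.a12 = 0 ∧ a.a14 = 0 ∧ a.a24 = 0 ∧ a.a34 = 0 ∧
      a.a25 = (-a.a13 * a.a15) / a.a23 ∧ a.a26 = (-a.a13 * a.a16) / a.a23 ∧ a.a35 = 0 ∧ a.a36 = 0},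
    {a | a.a23 ≠ 0 ∧ a.a13 = 0 ∧ a.a14 = 0 ∧ a.a24 = 0 ∧ a.a34 = 0 ∧ a.a25 = 0 ∧ a.a26 = 0 ∧
      a.a35 = (a.a12 * a.a15) / a.a23 ∧ a.a36 = (a.a12 * a.a16) / a.a23},
    {a | a.a23 ≠ 0 ∧ a.a14 = 0 ∧ a.a15 = 0 ∧ a.a24 = 0 ∧ a.a34 = 0 ∧ a.a25 = 0 ∧
      a.a26 = (-a.a13 * a.a16) / a.a23 ∧ a.a35 = 0 ∧ a.a36 = (a.a12 * a.a16) / a.a23},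
    {a | a.a13 ≠ 0 ∧ a.a14 = 0 ∧ a.a15 = 0 ∧ a.a16 = 0 ∧ a.a23 = 0 ∧ a.a24 = 0 ∧ a.a34 = 0 ∧
      a.a35 = (-a.a12 * a.a25) / a.a13 ∧ a.a36 = (-a.a12 * a.a26) / a.a13},
    {a | a.a24 ≠ 0 ∧ a.a13 = (a.a14 * a.a23) / a.a24 ∧ a.a15 = 0 ∧ a.a16 = 0 ∧ a.a25 = 0 ∧
      a.a26 = 0 ∧ a.a35 = 0 ∧ a.a36 = 0 ∧ a.a45 = 0 ∧ a.a46 = 0},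
    {a | a.a34 ≠ 0 ∧ a.a12 = 0 ∧ a.a14 = 0 ∧ a.a15 = 0 ∧ a.a23 = 0 ∧ a.a24 = 0 ∧ a.a35 = 0 ∧
      a.a36 = 0 ∧ a.a45 = 0 ∧ a.a46 = (a.a13 * a.a16) / a.a34},
    {a | a.a24 ≠ 0 ∧ a.a12 = 0 ∧ a.a13 = 0 ∧ a.a14 = 0 ∧ a.a15 = 0 ∧ a.a34 = 0 ∧ a.a25 = 0 ∧
      a.a26 = 0 ∧ a.a45 = (-a.a23 * a.a35) / a.a24 ∧ a.a46 = (-a.a23 * a.a36) / a.a24},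
    {a | a.a24 ≠ 0 ∧ a.a13 = 0 ∧ a.a14 = 0 ∧ a.a15 = 0 ∧ a.a23 = 0 ∧ a.a34 = 0 ∧ a.a25 = 0 ∧
      a.a26 = 0 ∧ a.a45 = 0 ∧ a.a46 = (a.a12 * a.a16) / a.a24},
    {a | a.a23 ≠ 0 ∧ a.a12 = 0 ∧ a.a14 = 0 ∧ a.a15 = 0 ∧ a.a24 = 0 ∧ a.a34 = 0 ∧ a.a25 = 0 ∧
      a.a26 = (-a.a13 * a.a16) / a.a23 ∧ a.a35 = 0 ∧ a.a36 = 0},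
    {a | a.a23 ≠ 0 ∧ a.a13 = 0 ∧ a.a14 = 0 ∧ a.a15 = 0 ∧ a.a24 = 0 ∧ a.a34 = 0 ∧ a.a25 = 0 ∧
      a.a26 = 0 ∧ a.a35 = 0 ∧ a.a36 = (a.a12 * a.a16) / a.a23},
    {a | a.a12 = 0 ∧ a.a14 = 0 ∧ a.a15 = 0 ∧ a.a16 = 0 ∧ a.a23 = 0 ∧ a.a24 = 0 ∧ a.a34 = 0 ∧
      a.a35 = 0 ∧ a.a36 = 0},
    {a | a.a13 = 0 ∧ a.a14 = 0 ∧ a.a15 = 0 ∧ a.a16 = 0 ∧ a.a23 = 0 ∧ a.a24 = 0 ∧ a.a34 = 0 ∧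
      a.a25 = 0 ∧ a.a26 = 0},
    {a | a.a14 = 0 ∧ a.a15 = 0 ∧ a.a16 = 0 ∧ a.a24 = 0 ∧ a.a25 = 0 ∧ a.a26 = 0 ∧ a.a35 = 0 ∧
      a.a36 = 0 ∧ a.a45 = 0 ∧ a.a46 = 0},
    {a | a.a15 = 0 ∧ a.a16 = 0 ∧ a.a23 = 0 ∧ a.a24 = 0 ∧ a.a25 = 0 ∧ a.a26 = 0 ∧ a.a35 = 0 ∧
      a.a36 = 0 ∧ a.a45 = 0 ∧ a.a46 = 0},
    {a | a.a12 = 0 ∧ a.a13 = 0 ∧ a.a14 = 0 ∧ a.a23 = 0 ∧ a.a24 = 0 ∧ a.a35 = 0 ∧ a.a36 = 0 ∧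
      a.a45 = 0 ∧ a.a46 = 0},
    {a | a.a14 = 0 ∧ a.a15 = 0 ∧ a.a16 = 0 ∧ a.a25 = 0 ∧ a.a26 = 0 ∧ a.a35 = 0 ∧ a.a36 = 0 ∧
      a.a45 = 0 ∧ a.a46 = 0},
    {a | a.a15 = 0 ∧ a.a16 = 0 ∧ a.a25 = 0 ∧ a.a26 = 0 ∧ a.a35 = 0 ∧ a.a36 = 0 ∧ a.a45 = 0 ∧
      a.a46 = 0},
    {a | a.a12 = 0 ∧ a.a13 = 0 ∧ a.a14 = 0 ∧ a.a23 = 0 ∧ a.a24 = 0 ∧ a.a34 = 0}]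

/-! ### Checks of the definitions -/

/-- `m` consists of the skew matrices whose lower right `2 × 2` block vanishes. -/
theorem mem_mSpace_iff (X : Matrix (Fin 6) (Fin 6) ℝ) :
    X ∈ mSpace ↔ Xᵀ = -X ∧ X 4 5 = 0 := by
  constructor
  · rintro ⟨hX, h⟩
    rw [LieAlgebra.Orthogonal.mem_so] at hX
    refine ⟨hX, ?_⟩
    have h54 : X 5 4 = -X 4 5 := congrFun (congrFun hX 4) 5
    have hxi : xi 4 5 ∈ hSpace := by
      refine ⟨?_, ?_⟩
      · rw [LieAlgebra.Orthogonal.mem_so]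
        simp [xi, Matrix.transpose_sub, Matrix.transpose_single]
      · intro i j hij
        fin_cases i <;> fin_cases j <;> simp_all [xi, Matrix.single]
    have hB := h _ hxi
    simp [B, xi, mul_sub, Matrix.trace_mul_single] at hB
    linarith
  · rintro ⟨hX, h45⟩
    refine ⟨(LieAlgebra.Orthogonal.mem_so _ _ _).2 hX, ?_⟩
    rintro Y ⟨hY, hY0⟩
    rw [LieAlgebra.Orthogonal.mem_so] at hY
    have hs : ∀ (M : Matrix (Fin 6) (Fin 6) ℝ), Mᵀ = -M → ∀ i j, M j i = -M i j :=
      fun M hM i j => congrFun (congrFun hM i) j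
    have h54 : X 5 4 = 0 := by rw [hs X hX 4 5, h45, neg_zero]
    have h44 : X 4 4 = 0 := by linarith [hs X hX 4 4]
    have h55 : X 5 5 = 0 := by linarith [hs X hX 5 5]
    have key : ∀ i j, X i j * Y j i = 0 := by
      intro i j
      by_cases hi : j < 4 ∨ i < 4
      · rw [hY0 j i hi, mul_zero]
      · have : X i j = 0 := by
          fin_cases i <;> fin_cases j <;> first
            | exact absurd (by decide) hi
            | assumption
        rw [this, zero_mul]
    simp [B, Matrix.trace, Matrix.mul_apply, key]

theorem sum_sq_eq_trace (M : Matrix (Fin 6) (Fin 4) ℝ) :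
    ∑ i, ∑ j, M i j ^ 2 = (Mᵀ * M).trace := by
  rw [Finset.sum_comm]
  simp [Matrix.trace, Matrix.mul_apply, sq]

/-- `metricSq x` is the `SO(6)`-invariant metric on the Stiefel manifold given by `innerM x` on
`m ≅ T_o`, where `g ∈ SO(6)` moves the tangent vector `Z · o` at `o` to `g · Z · o` at `g · o`. -/
theorem metricSq_smul (x : ℝ) (g : Matrix (Fin 6) (Fin 6) ℝ)
    (hg : g ∈ Matrix.specialOrthogonalGroup (Fin 6) ℝ)
    (Z : Matrix (Fin 6) (Fin 6) ℝ) (hZ : Z ∈ mSpace) :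
    metricSq x (g * origin) (g * (Z * origin)) = innerM x Z Z := by
  have hgg : gᵀ * g = 1 := by
    have := (Matrix.mem_specialOrthogonalGroup_iff.1 hg).1
    exact (Matrix.mem_orthogonalGroup_iff' _ _).1 this
  have h1 : (g * origin)ᵀ * (g * (Z * origin)) = originᵀ * (Z * origin) := by
    rw [Matrix.transpose_mul, Matrix.mul_assoc, ← Matrix.mul_assoc gᵀ, hgg, Matrix.one_mul]
  have h2 : (g * (Z * origin))ᵀ * (g * (Z * origin)) = (Z * origin)ᵀ * (Z * origin) := by
    rw [Matrix.transpose_mul, Matrix.mul_assoc, ← Matrix.mul_assoc gᵀ, hgg, Matrix.one_mul]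
  rw [metricSq, h1, sum_sq_eq_trace, h2, ← sum_sq_eq_trace]
  obtain ⟨hs, h45⟩ := (mem_mSpace_iff Z).1 hZ
  have e : ∀ i j, Z j i = -Z i j := fun i j => congrFun (congrFun hs i) j
  have d : ∀ i, Z i i = 0 := fun i => by linarith [e i i]
  have hP : ∀ i j, (originᵀ * (Z * origin)) i j =
      Z (i.castLE (by norm_num)) (j.castLE (by norm_num)) := by
    intro i j
    fin_cases i <;> fin_cases j <;> simp [origin, Matrix.mul_apply, Fin.sum_univ_succ]
  have hN : ∀ i j, (Z * origin) i j = Z i (j.castLE (by norm_num)) := by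
    intro i j
    fin_cases j <;> simp [origin, Matrix.mul_apply, Fin.sum_univ_succ]
  have hI : innerM x Z Z = 4 * ∑ i, ∑ j, jensenOp x Z i j * Z i j := by
    simp only [innerM, B, Matrix.trace, Matrix.diag_apply, Matrix.mul_apply]
    rw [neg_mul, ← mul_neg, ← Finset.sum_neg_distrib]
    congr 1
    refine Finset.sum_congr rfl fun i _ => ?_
    rw [← Finset.sum_neg_distrib]
    refine Finset.sum_congr rfl fun j _ => ?_
    rw [e i j]
    ring
  have h54 : Z 5 4 = 0 := by rw [e 4 5, h45, neg_zero]
  rw [hI]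
  simp only [hP, hN]
  simp [jensenOp, metricOp, part, blk, Fin.sum_univ_succ, d, Fin.castLE]
  rw [e 0 1, e 0 2, e 0 3, e 0 4, e 0 5, e 1 2, e 1 3, e 1 4, e 1 5, e 2 3, e 2 4, e 2 5, e 3 4,
    e 3 5]
  ring

end StiefelV4R6

end

open StiefelV4R6

open StiefelV4R6

noncomputable section

namespace StiefelV4R6

/-! Split `X ∈ m` as `A + n`, with `A` in `so(4) = so(3) ⊕ m₁₂` and `n` in `m₁₃ ⊕ m₂₃`; then `Λ` is
`x` on `A` and `1` on `n`.

Einstein condition: computing the connection and curvature in coordinates shows that the Ricci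
tensor is diagonal for this splitting (`ricci_toMat`), with values `1 + x²` and `4 - 3x/2` where the
metric has `8x` and `8`. Proportionality is the quadratic `5x² - 8x + 2 = 0`. The value `x = 1` is
not a root.

Geodesics: let `o` be the base frame, read `A` as the 4 × 4 matrix `tangentBlock X`, and let `N` be
the part of `X o` normal to the span of `o`. Along an orbit the tangential part of the velocity is
constantly `A`. Integration by parts turns the first variation of the energy into `-8(x - 1) ∫
⟨exp(tX) D, V⟩ dt` with `D = N A` (`normalDefect`), because the rest of the Euler-Lagrange
expression has the form `exp(tX) o S` with `S` symmetric and is orthogonal to tangent vectors. For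
`x ≠ 1` the orbit is therefore a geodesic iff `D = 0` (`isGeodesic_orbit_iff`); if `D ≠ 0`, the
variation with field `t(1 - t) exp(tX) D` detects it. The condition `D = 0` says that both nonzero
rows of `N` are annihilated by the skew matrix `A`. These are the eight bilinear equations, and `x`
has disappeared from them. The bracket conditions say the same, since `[X, ΛX] = (1 - x)[A, n]`.

Solutions: if the Pfaffian of `A` is nonzero, then `n = 0`. Otherwise `A` has rank at most 2, and
the system is solved with the first nonzero entry of `A` as pivot. Eight of the families already
cover all solutions; the others only have to consist of solutions. Seventeen sample solutions tell
the 42 families apart. -/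

/-! ### Brackets, connection and curvature in the fourteen coordinates of `m`. -/

/-- The element of `m` with given coefficients. -/
def toMat (a : Coeff) : Matrix (Fin 6) (Fin 6) ℝ :=
  !![0, a.a12, a.a13, a.a14, a.a15, a.a16;
    -a.a12, 0, a.a23, a.a24, a.a25, a.a26;
    -a.a13, -a.a23, 0, a.a34, a.a35, a.a36;
    -a.a14, -a.a24, -a.a34, 0, a.a45, a.a46;
    -a.a15, -a.a25, -a.a35, -a.a45, 0, 0;
    -a.a16, -a.a26, -a.a36, -a.a46, 0, 0]

/-- With `coeff_toMat` this identifies `m` with `Coeff`, so every claim about `m` becomes one about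
fourteen real numbers. -/
theorem toMat_coeff {X : Matrix (Fin 6) (Fin 6) ℝ} (hX : X ∈ mSpace) : toMat (coeff X) = X := by
  obtain ⟨hs, h45⟩ := (mem_mSpace_iff X).1 hX
  have e : ∀ i j, X j i = -X i j := fun i j => congrFun (congrFun hs i) j
  have d : ∀ i, X i i = 0 := fun i => by linarith [e i i]
  have h54 : X 5 4 = 0 := by rw [e 4 5, h45, neg_zero]
  ext i j
  fin_cases i <;> fin_cases j <;> first
    | rfl
    | exact (d _).symm
    | exact (e _ _).symm
    | exact h45.symm
    | exact h54.symm

theorem coeff_toMat (a : Coeff) : coeff (toMat a) = a := rfl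

theorem toMat_mem_mSpace (a : Coeff) : toMat a ∈ mSpace := by
  rw [mem_mSpace_iff]
  refine ⟨?_, rfl⟩
  ext i j
  fin_cases i <;> fin_cases j <;> simp [toMat]

/-- The entries above the diagonal of the product of two elements of `m`. -/
def prodC (X Y : Coeff) : Coeff where
  a12 := -(X.a13 * Y.a23) - X.a14 * Y.a24 - X.a15 * Y.a25 - X.a16 * Y.a26
  a13 := X.a12 * Y.a23 - X.a14 * Y.a34 - X.a15 * Y.a35 - X.a16 * Y.a36
  a14 := X.a12 * Y.a24 + X.a13 * Y.a34 - X.a15 * Y.a45 - X.a16 * Y.a46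
  a15 := X.a12 * Y.a25 + X.a13 * Y.a35 + X.a14 * Y.a45
  a16 := X.a12 * Y.a26 + X.a13 * Y.a36 + X.a14 * Y.a46
  a23 := -(X.a12 * Y.a13) - X.a24 * Y.a34 - X.a25 * Y.a35 - X.a26 * Y.a36
  a24 := -(X.a12 * Y.a14) + X.a23 * Y.a34 - X.a25 * Y.a45 - X.a26 * Y.a46
  a25 := -(X.a12 * Y.a15) + X.a23 * Y.a35 + X.a24 * Y.a45
  a26 := -(X.a12 * Y.a16) + X.a23 * Y.a36 + X.a24 * Y.a46
  a34 := -(X.a13 * Y.a14) - X.a23 * Y.a24 - X.a35 * Y.a45 - X.a36 * Y.a46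
  a35 := -(X.a13 * Y.a15) - X.a23 * Y.a25 + X.a34 * Y.a45
  a36 := -(X.a13 * Y.a16) - X.a23 * Y.a26 + X.a34 * Y.a46
  a45 := -(X.a14 * Y.a15) - X.a24 * Y.a25 - X.a34 * Y.a35
  a46 := -(X.a14 * Y.a16) - X.a24 * Y.a26 - X.a34 * Y.a36

/-- The coefficients of the Nomizu map. -/
def nablaC (x : ℝ) (X Y : Coeff) : Coeff where
  a12 := 1 / 2 * ((prodC X Y).a12 - (prodC Y X).a12)
  a13 := 1 / 2 * ((prodC X Y).a13 - (prodC Y X).a13)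
  a14 := 1 / 2 * ((prodC X Y).a14 - (prodC Y X).a14)
  a15 := (1 - x / 2) * (prodC X Y).a15 - x / 2 * (prodC Y X).a15
  a16 := (1 - x / 2) * (prodC X Y).a16 - x / 2 * (prodC Y X).a16
  a23 := 1 / 2 * ((prodC X Y).a23 - (prodC Y X).a23)
  a24 := 1 / 2 * ((prodC X Y).a24 - (prodC Y X).a24)
  a25 := (1 - x / 2) * (prodC X Y).a25 - x / 2 * (prodC Y X).a25
  a26 := (1 - x / 2) * (prodC X Y).a26 - x / 2 * (prodC Y X).a26
  a34 := 1 / 2 * ((prodC X Y).a34 - (prodC Y X).a34)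
  a35 := (1 - x / 2) * (prodC X Y).a35 - x / 2 * (prodC Y X).a35
  a36 := (1 - x / 2) * (prodC X Y).a36 - x / 2 * (prodC Y X).a36
  a45 := (1 - x / 2) * (prodC X Y).a45 - x / 2 * (prodC Y X).a45
  a46 := (1 - x / 2) * (prodC X Y).a46 - x / 2 * (prodC Y X).a46

/-- The coefficients of the `m`-component of the bracket. -/
def bracketC (X Y : Coeff) : Coeff where
  a12 := (prodC X Y).a12 - (prodC Y X).a12
  a13 := (prodC X Y).a13 - (prodC Y X).a13
  a14 := (prodC X Y).a14 - (prodC Y X).a14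
  a15 := (prodC X Y).a15 - (prodC Y X).a15
  a16 := (prodC X Y).a16 - (prodC Y X).a16
  a23 := (prodC X Y).a23 - (prodC Y X).a23
  a24 := (prodC X Y).a24 - (prodC Y X).a24
  a25 := (prodC X Y).a25 - (prodC Y X).a25
  a26 := (prodC X Y).a26 - (prodC Y X).a26
  a34 := (prodC X Y).a34 - (prodC Y X).a34
  a35 := (prodC X Y).a35 - (prodC Y X).a35
  a36 := (prodC X Y).a36 - (prodC Y X).a36
  a45 := (prodC X Y).a45 - (prodC Y X).a45
  a46 := (prodC X Y).a46 - (prodC Y X).a46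

/-- The `so(2)`-component of the bracket. -/
def isoC (X Y : Coeff) : ℝ :=
  Y.a15 * X.a16 - X.a15 * Y.a16 + (Y.a25 * X.a26 - X.a25 * Y.a26)
    + (Y.a35 * X.a36 - X.a35 * Y.a36) + (Y.a45 * X.a46 - X.a45 * Y.a46)

/-- The action of the isotropy algebra on `m`. -/
def rotC (h : ℝ) (Z : Coeff) : Coeff where
  a12 := 0
  a13 := 0
  a14 := 0
  a15 := h * Z.a16
  a16 := -(h * Z.a15)
  a23 := 0
  a24 := 0
  a25 := h * Z.a26
  a26 := -(h * Z.a25)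
  a34 := 0
  a35 := h * Z.a36
  a36 := -(h * Z.a35)
  a45 := h * Z.a46
  a46 := -(h * Z.a45)

/-- The coefficients of the curvature tensor. -/
def curvC (x : ℝ) (X Y Z : Coeff) : Coeff where
  a12 := (nablaC x X (nablaC x Y Z)).a12 - (nablaC x Y (nablaC x X Z)).a12
    - (nablaC x (bracketC X Y) Z).a12 - (rotC (isoC X Y) Z).a12
  a13 := (nablaC x X (nablaC x Y Z)).a13 - (nablaC x Y (nablaC x X Z)).a13
    - (nablaC x (bracketC X Y) Z).a13 - (rotC (isoC X Y) Z).a13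
  a14 := (nablaC x X (nablaC x Y Z)).a14 - (nablaC x Y (nablaC x X Z)).a14
    - (nablaC x (bracketC X Y) Z).a14 - (rotC (isoC X Y) Z).a14
  a15 := (nablaC x X (nablaC x Y Z)).a15 - (nablaC x Y (nablaC x X Z)).a15
    - (nablaC x (bracketC X Y) Z).a15 - (rotC (isoC X Y) Z).a15
  a16 := (nablaC x X (nablaC x Y Z)).a16 - (nablaC x Y (nablaC x X Z)).a16
    - (nablaC x (bracketC X Y) Z).a16 - (rotC (isoC X Y) Z).a16
  a23 := (nablaC x X (nablaC x Y Z)).a23 - (nablaC x Y (nablaC x X Z)).a23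
    - (nablaC x (bracketC X Y) Z).a23 - (rotC (isoC X Y) Z).a23
  a24 := (nablaC x X (nablaC x Y Z)).a24 - (nablaC x Y (nablaC x X Z)).a24
    - (nablaC x (bracketC X Y) Z).a24 - (rotC (isoC X Y) Z).a24
  a25 := (nablaC x X (nablaC x Y Z)).a25 - (nablaC x Y (nablaC x X Z)).a25
    - (nablaC x (bracketC X Y) Z).a25 - (rotC (isoC X Y) Z).a25
  a26 := (nablaC x X (nablaC x Y Z)).a26 - (nablaC x Y (nablaC x X Z)).a26
    - (nablaC x (bracketC X Y) Z).a26 - (rotC (isoC X Y) Z).a26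
  a34 := (nablaC x X (nablaC x Y Z)).a34 - (nablaC x Y (nablaC x X Z)).a34
    - (nablaC x (bracketC X Y) Z).a34 - (rotC (isoC X Y) Z).a34
  a35 := (nablaC x X (nablaC x Y Z)).a35 - (nablaC x Y (nablaC x X Z)).a35
    - (nablaC x (bracketC X Y) Z).a35 - (rotC (isoC X Y) Z).a35
  a36 := (nablaC x X (nablaC x Y Z)).a36 - (nablaC x Y (nablaC x X Z)).a36
    - (nablaC x (bracketC X Y) Z).a36 - (rotC (isoC X Y) Z).a36
  a45 := (nablaC x X (nablaC x Y Z)).a45 - (nablaC x Y (nablaC x X Z)).a45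
    - (nablaC x (bracketC X Y) Z).a45 - (rotC (isoC X Y) Z).a45
  a46 := (nablaC x X (nablaC x Y Z)).a46 - (nablaC x Y (nablaC x X Z)).a46
    - (nablaC x (bracketC X Y) Z).a46 - (rotC (isoC X Y) Z).a46

theorem ext_coeff {X Y : Matrix (Fin 6) (Fin 6) ℝ} (hX : X ∈ mSpace) (hY : Y ∈ mSpace)
    (h : coeff X = coeff Y) : X = Y := by
  rw [← toMat_coeff hX, ← toMat_coeff hY, h]

theorem part_transpose (p q : Fin 3) (X : Matrix (Fin 6) (Fin 6) ℝ) :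
    (part p q X)ᵀ = part p q Xᵀ := by
  ext i j
  simp only [part, Matrix.transpose_apply, Matrix.of_apply, and_comm, or_comm]

theorem part_neg (p q : Fin 3) (X : Matrix (Fin 6) (Fin 6) ℝ) : part p q (-X) = -part p q X := by
  ext i j
  simp only [part, Matrix.neg_apply, Matrix.of_apply]
  split_ifs <;> simp

theorem projM_mem_mSpace {X : Matrix (Fin 6) (Fin 6) ℝ} (hX : Xᵀ = -X) : projM X ∈ mSpace := by
  rw [mem_mSpace_iff]
  refine ⟨?_, ?_⟩
  · rw [projM, projH, Matrix.transpose_sub, part_transpose, hX, part_neg]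
    abel
  · simp [projM, projH, part, blk]

theorem bracket_transpose {X Y : Matrix (Fin 6) (Fin 6) ℝ} (hX : Xᵀ = -X) (hY : Yᵀ = -Y) :
    ⁅X, Y⁆ᵀ = -⁅X, Y⁆ := by
  rw [Ring.lie_def, Matrix.transpose_sub, Matrix.transpose_mul, Matrix.transpose_mul, hX, hY]
  simp

theorem toMat_transpose (a : Coeff) : (toMat a)ᵀ = -toMat a :=
  ((mem_mSpace_iff _).1 (toMat_mem_mSpace a)).1

theorem projM_apply_of_blk {i j : Fin 6} (h : blk i ≠ 2) (X : Matrix (Fin 6) (Fin 6) ℝ) :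
    projM X i j = X i j := by
  simp [projM, projH, part, h]

theorem bracket_apply (X Y : Matrix (Fin 6) (Fin 6) ℝ) (i j : Fin 6) :
    ⁅X, Y⁆ i j = X i 0 * Y 0 j + X i 1 * Y 1 j + X i 2 * Y 2 j + X i 3 * Y 3 j + X i 4 * Y 4 j
      + X i 5 * Y 5 j - (Y i 0 * X 0 j + Y i 1 * X 1 j + Y i 2 * X 2 j + Y i 3 * X 3 j
      + Y i 4 * X 4 j + Y i 5 * X 5 j) := by
  rw [Ring.lie_def, Matrix.sub_apply, Matrix.mul_apply, Matrix.mul_apply, Fin.sum_univ_six,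
    Fin.sum_univ_six]

theorem projM_bracket_toMat (X Y : Coeff) :
    projM ⁅toMat X, toMat Y⁆ = toMat (bracketC X Y) := by
  refine ext_coeff (projM_mem_mSpace (bracket_transpose (toMat_transpose X) (toMat_transpose Y)))
    (toMat_mem_mSpace _) ?_
  rw [coeff_toMat, coeff]; simp only [bracketC, Coeff.mk.injEq]
  refine ⟨?_, ?_, ?_, ?_, ?_, ?_, ?_, ?_, ?_, ?_, ?_, ?_, ?_, ?_⟩ <;>
    rw [projM_apply_of_blk (by decide), bracket_apply] <;>
    simp [toMat, prodC] <;> ring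

theorem projH_bracket_toMat (X Y : Coeff) :
    projH ⁅toMat X, toMat Y⁆ = isoC X Y • xi 4 5 := by
  have h := bracket_transpose (toMat_transpose X) (toMat_transpose Y)
  have e : ∀ i j, ⁅toMat X, toMat Y⁆ j i = -⁅toMat X, toMat Y⁆ i j :=
    fun i j => congrFun (congrFun h i) j
  have d : ∀ i, ⁅toMat X, toMat Y⁆ i i = 0 := fun i => by linarith [e i i]
  have h45 : ⁅toMat X, toMat Y⁆ 4 5 = isoC X Y := by
    rw [bracket_apply]
    simp [toMat, isoC]
    ring
  ext i j
  fin_cases i <;> fin_cases j <;>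
    simp [projH, part, blk, xi, Matrix.single, d, e 4 5, h45]

theorem bracket_isotropy_toMat (h : ℝ) (Z : Coeff) :
    ⁅h • xi 4 5, toMat Z⁆ = toMat (rotC h Z) := by
  have hxi : (h • xi 4 5)ᵀ = -(h • xi 4 5) := by
    simp [xi, Matrix.transpose_sub, Matrix.transpose_single, smul_sub]
  refine ext_coeff ((mem_mSpace_iff _).2 ⟨bracket_transpose hxi (toMat_transpose Z), ?_⟩)
    (toMat_mem_mSpace _) ?_
  · rw [bracket_apply]
    simp [toMat, xi, Matrix.single, mul_comm]
  rw [coeff_toMat, coeff, rotC, Coeff.mk.injEq]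
  refine ⟨?_, ?_, ?_, ?_, ?_, ?_, ?_, ?_, ?_, ?_, ?_, ?_, ?_, ?_⟩ <;>
    rw [bracket_apply] <;>
    simp [toMat, xi, Matrix.single, mul_comm]

/-- `Λ` in coefficients. -/
def jensenC (x : ℝ) (X : Coeff) : Coeff where
  a12 := x * X.a12
  a13 := x * X.a13
  a14 := x * X.a14
  a15 := X.a15
  a16 := X.a16
  a23 := x * X.a23
  a24 := x * X.a24
  a25 := X.a25
  a26 := X.a26
  a34 := x * X.a34
  a35 := X.a35
  a36 := X.a36
  a45 := X.a45
  a46 := X.a46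

theorem jensenOp_toMat (x : ℝ) (X : Coeff) : jensenOp x (toMat X) = toMat (jensenC x X) := by
  ext i j
  fin_cases i <;> fin_cases j <;> simp [jensenOp, metricOp, part, blk, toMat, jensenC]

theorem jensenOpInv_toMat (x : ℝ) (X : Coeff) :
    jensenOpInv x (toMat X) = toMat (jensenC x⁻¹ X) := by
  ext i j
  fin_cases i <;> fin_cases j <;> simp [jensenOpInv, metricOp, part, blk, toMat, jensenC]

theorem projM_add (X Y : Matrix (Fin 6) (Fin 6) ℝ) : projM (X + Y) = projM X + projM Y := by
  ext i j
  simp only [projM, projH, part, Matrix.sub_apply, Matrix.add_apply, Matrix.of_apply]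
  split_ifs <;> ring

/-- The sum of coefficients. -/
def addC (X Y : Coeff) : Coeff where
  a12 := X.a12 + Y.a12
  a13 := X.a13 + Y.a13
  a14 := X.a14 + Y.a14
  a15 := X.a15 + Y.a15
  a16 := X.a16 + Y.a16
  a23 := X.a23 + Y.a23
  a24 := X.a24 + Y.a24
  a25 := X.a25 + Y.a25
  a26 := X.a26 + Y.a26
  a34 := X.a34 + Y.a34
  a35 := X.a35 + Y.a35
  a36 := X.a36 + Y.a36
  a45 := X.a45 + Y.a45
  a46 := X.a46 + Y.a46

theorem toMat_add (X Y : Coeff) : toMat X + toMat Y = toMat (addC X Y) := by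
  ext i j
  fin_cases i <;> fin_cases j <;> simp [toMat, addC] <;> ring

/-- Breaks a matrix identity into fourteen scalar ones, each a polynomial identity to be checked by
itself. -/
theorem smul_toMat_add_smul_toMat (r : ℝ) (X Y Z : Coeff)
    (h : ∀ f ∈ [Coeff.a12, Coeff.a13, Coeff.a14, Coeff.a15, Coeff.a16, Coeff.a23, Coeff.a24,
      Coeff.a25, Coeff.a26, Coeff.a34, Coeff.a35, Coeff.a36, Coeff.a45, Coeff.a46],
      r * f X + r * f Y = f Z) :
    r • toMat X + r • toMat Y = toMat Z := by
  simp only [List.forall_mem_cons] at h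
  obtain ⟨h1, h2, h3, h4, h5, h6, h7, h8, h9, h10, h11, h12, h13, h14, -⟩ := h
  ext i j
  fin_cases i <;> fin_cases j <;> simp [toMat] <;> linarith

/-- The symmetric term `[X, ΛY] + [Y, ΛX]` has no `so(4)`-component, by antisymmetry of the bracket
on each summand. So `x⁻¹` only ever multiplies zero, and the formula holds for every `x`, including
`0`. -/
theorem nabla_toMat (x : ℝ) (X Y : Coeff) :
    nabla x (toMat X) (toMat Y) = toMat (nablaC x X Y) := by
  rw [nabla, jensenOp_toMat, jensenOp_toMat, projM_add, projM_bracket_toMat, projM_bracket_toMat,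
    projM_bracket_toMat, toMat_add, jensenOpInv_toMat]
  apply smul_toMat_add_smul_toMat
  simp only [List.forall_mem_cons, List.not_mem_nil, false_imp_iff, implies_true, and_true, bracketC,
    jensenC, addC, nablaC, prodC]
  refine ⟨?_, ?_, ?_, ?_, ?_, ?_, ?_, ?_, ?_, ?_, ?_, ?_, ?_, ?_⟩ <;> ring

theorem curv_toMat (x : ℝ) (X Y Z : Coeff) :
    curv x (toMat X) (toMat Y) (toMat Z) = toMat (curvC x X Y Z) := by
  rw [curv, projM_bracket_toMat, projH_bracket_toMat, bracket_isotropy_toMat]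
  simp only [nabla_toMat]
  ext i j
  fin_cases i <;> fin_cases j <;> simp [toMat, curvC] <;> ring

/-! ### The Ricci tensor and the Einstein equation. -/

theorem xi_mem_mSpace {a : Fin 6} (h : a < 4) (b : Fin 6) : xi a b ∈ mSpace := by
  refine (mem_mSpace_iff _).2 ⟨?_, ?_⟩
  · simp [xi, Matrix.transpose_sub, Matrix.transpose_single]
  · have h4 : a ≠ 4 := by omega
    have h5 : a ≠ 5 := by omega
    simp [xi, Matrix.single, h4, h5]

theorem curv_xi_apply {a b : Fin 6} (h : a < 4) {E : Coeff} (hE : coeff (xi a b) = E) (x : ℝ)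
    (Y Z : Coeff) :
    curv x (xi a b) (toMat Y) (toMat Z) a b = toMat (curvC x E Y Z) a b := by
  rw [← hE, ← curv_toMat, toMat_coeff (xi_mem_mSpace h b)]

theorem ricci_eq_sum (x : ℝ) (Y Z : Matrix (Fin 6) (Fin 6) ℝ) :
    ricci x Y Z =
      curv x (xi 0 1) Y Z 0 1
      + curv x (xi 0 2) Y Z 0 2
      + curv x (xi 0 3) Y Z 0 3
      + curv x (xi 0 4) Y Z 0 4
      + curv x (xi 0 5) Y Z 0 5
      + curv x (xi 1 2) Y Z 1 2
      + curv x (xi 1 3) Y Z 1 3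
      + curv x (xi 1 4) Y Z 1 4
      + curv x (xi 1 5) Y Z 1 5
      + curv x (xi 2 3) Y Z 2 3
      + curv x (xi 2 4) Y Z 2 4
      + curv x (xi 2 5) Y Z 2 5
      + curv x (xi 3 4) Y Z 3 4
      + curv x (xi 3 5) Y Z 3 5 := by
  simp [ricci, Fin.sum_univ_six]
  ring

/-- The Ricci tensor is diagonal with respect to `so(4) ⊕ (m₁₃ ⊕ m₂₃)`. -/
theorem ricci_toMat (x : ℝ) (Y Z : Coeff) :
    ricci x (toMat Y) (toMat Z) =
      (1 + x ^ 2) * (Y.a12 * Z.a12 + Y.a13 * Z.a13 + Y.a14 * Z.a14 + Y.a23 * Z.a23 + Y.a24 * Z.a24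
        + Y.a34 * Z.a34)
      + (4 - 3 / 2 * x) * (Y.a15 * Z.a15 + Y.a16 * Z.a16 + Y.a25 * Z.a25 + Y.a26 * Z.a26
        + Y.a35 * Z.a35 + Y.a36 * Z.a36 + Y.a45 * Z.a45 + Y.a46 * Z.a46) := by
  rw [ricci_eq_sum,
    curv_xi_apply (a := 0) (b := 1) (E := ⟨1, 0, 0, 0, 0, 0, 0, 0, 0, 0, 0, 0, 0, 0⟩) (by decide)
      (by simp [coeff, xi, Matrix.single]),
    curv_xi_apply (a := 0) (b := 2) (E := ⟨0, 1, 0, 0, 0, 0, 0, 0, 0, 0, 0, 0, 0, 0⟩) (by decide)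
      (by simp [coeff, xi, Matrix.single]),
    curv_xi_apply (a := 0) (b := 3) (E := ⟨0, 0, 1, 0, 0, 0, 0, 0, 0, 0, 0, 0, 0, 0⟩) (by decide)
      (by simp [coeff, xi, Matrix.single]),
    curv_xi_apply (a := 0) (b := 4) (E := ⟨0, 0, 0, 1, 0, 0, 0, 0, 0, 0, 0, 0, 0, 0⟩) (by decide)
      (by simp [coeff, xi, Matrix.single]),
    curv_xi_apply (a := 0) (b := 5) (E := ⟨0, 0, 0, 0, 1, 0, 0, 0, 0, 0, 0, 0, 0, 0⟩) (by decide)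
      (by simp [coeff, xi, Matrix.single]),
    curv_xi_apply (a := 1) (b := 2) (E := ⟨0, 0, 0, 0, 0, 1, 0, 0, 0, 0, 0, 0, 0, 0⟩) (by decide)
      (by simp [coeff, xi, Matrix.single]),
    curv_xi_apply (a := 1) (b := 3) (E := ⟨0, 0, 0, 0, 0, 0, 1, 0, 0, 0, 0, 0, 0, 0⟩) (by decide)
      (by simp [coeff, xi, Matrix.single]),
    curv_xi_apply (a := 1) (b := 4) (E := ⟨0, 0, 0, 0, 0, 0, 0, 1, 0, 0, 0, 0, 0, 0⟩) (by decide)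
      (by simp [coeff, xi, Matrix.single]),
    curv_xi_apply (a := 1) (b := 5) (E := ⟨0, 0, 0, 0, 0, 0, 0, 0, 1, 0, 0, 0, 0, 0⟩) (by decide)
      (by simp [coeff, xi, Matrix.single]),
    curv_xi_apply (a := 2) (b := 3) (E := ⟨0, 0, 0, 0, 0, 0, 0, 0, 0, 1, 0, 0, 0, 0⟩) (by decide)
      (by simp [coeff, xi, Matrix.single]),
    curv_xi_apply (a := 2) (b := 4) (E := ⟨0, 0, 0, 0, 0, 0, 0, 0, 0, 0, 1, 0, 0, 0⟩) (by decide)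
      (by simp [coeff, xi, Matrix.single]),
    curv_xi_apply (a := 2) (b := 5) (E := ⟨0, 0, 0, 0, 0, 0, 0, 0, 0, 0, 0, 1, 0, 0⟩) (by decide)
      (by simp [coeff, xi, Matrix.single]),
    curv_xi_apply (a := 3) (b := 4) (E := ⟨0, 0, 0, 0, 0, 0, 0, 0, 0, 0, 0, 0, 1, 0⟩) (by decide)
      (by simp [coeff, xi, Matrix.single]),
    curv_xi_apply (a := 3) (b := 5) (E := ⟨0, 0, 0, 0, 0, 0, 0, 0, 0, 0, 0, 0, 0, 1⟩) (by decide)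
      (by simp [coeff, xi, Matrix.single])]
  -- The `(a, b)` entry of `toMat` is by definition the coefficient of `ξ_ab`, so the trace is a sum
  -- of diagonal coefficients of the curvature operator.
  change (curvC _ _ _ _).a12
    + (curvC _ _ _ _).a13
    + (curvC _ _ _ _).a14
    + (curvC _ _ _ _).a15
    + (curvC _ _ _ _).a16
    + (curvC _ _ _ _).a23
    + (curvC _ _ _ _).a24
    + (curvC _ _ _ _).a25
    + (curvC _ _ _ _).a26
    + (curvC _ _ _ _).a34
    + (curvC _ _ _ _).a35
    + (curvC _ _ _ _).a36
    + (curvC _ _ _ _).a45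
    + (curvC _ _ _ _).a46 = _
  simp only [curvC, nablaC, bracketC, prodC, rotC, isoC, mul_zero, zero_mul, sub_zero, zero_sub,
    add_zero, zero_add, mul_one, one_mul, neg_zero, sub_self]
  ring

theorem innerM_toMat (x : ℝ) (Y Z : Coeff) :
    innerM x (toMat Y) (toMat Z) =
      8 * (x * (Y.a12 * Z.a12 + Y.a13 * Z.a13 + Y.a14 * Z.a14 + Y.a23 * Z.a23 + Y.a24 * Z.a24
        + Y.a34 * Z.a34)
      + (Y.a15 * Z.a15 + Y.a16 * Z.a16 + Y.a25 * Z.a25 + Y.a26 * Z.a26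
        + Y.a35 * Z.a35 + Y.a36 * Z.a36 + Y.a45 * Z.a45 + Y.a46 * Z.a46)) := by
  rw [innerM, jensenOp_toMat, B]
  simp only [Matrix.trace, Matrix.diag_apply, Matrix.mul_apply, Fin.sum_univ_six]
  simp [toMat, jensenC]
  ring

theorem isEinstein_iff_quadratic {x : ℝ} :
    IsEinstein x ↔ 5 * x ^ 2 - 8 * x + 2 = 0 := by
  constructor
  · rintro ⟨c, hc⟩
    -- The test vectors `ξ₁₂` and `ξ₁₅` give `1 + x² = 8cx` and `4 - 3x/2 = 8c`; eliminating `c`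
    -- leaves the quadratic.
    have h1 := hc _ (toMat_mem_mSpace ⟨1, 0, 0, 0, 0, 0, 0, 0, 0, 0, 0, 0, 0, 0⟩) _
      (toMat_mem_mSpace ⟨1, 0, 0, 0, 0, 0, 0, 0, 0, 0, 0, 0, 0, 0⟩)
    have h2 := hc _ (toMat_mem_mSpace ⟨0, 0, 0, 1, 0, 0, 0, 0, 0, 0, 0, 0, 0, 0⟩) _
      (toMat_mem_mSpace ⟨0, 0, 0, 1, 0, 0, 0, 0, 0, 0, 0, 0, 0, 0⟩)
    rw [ricci_toMat, innerM_toMat] at h1 h2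
    norm_num at h1 h2
    linear_combination 2 * h1 - 2 * x * h2
  · intro h
    -- The constant is forced by the directions of `m₁₃ ⊕ m₂₃`; the quadratic then settles those of
    -- `so(4)`.
    refine ⟨(4 - 3 / 2 * x) / 8, fun Y hY Z hZ => ?_⟩
    rw [← toMat_coeff hY, ← toMat_coeff hZ, ricci_toMat, innerM_toMat]
    linear_combination (1 / 2) * ((coeff Y).a12 * (coeff Z).a12 + (coeff Y).a13 * (coeff Z).a13
      + (coeff Y).a14 * (coeff Z).a14 + (coeff Y).a23 * (coeff Z).a23
      + (coeff Y).a24 * (coeff Z).a24 + (coeff Y).a34 * (coeff Z).a34) * h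

theorem isEinstein_iff {x : ℝ} :
    IsEinstein x ↔ x = (4 + Real.sqrt 6) / 5 ∨ x = (4 - Real.sqrt 6) / 5 := by
  have h6 : Real.sqrt 6 ^ 2 = 6 := Real.sq_sqrt (by norm_num)
  have e : 5 * x ^ 2 - 8 * x + 2
      = 5 * ((x - (4 + Real.sqrt 6) / 5) * (x - (4 - Real.sqrt 6) / 5)) := by
    linear_combination (1 / 5) * h6
  rw [isEinstein_iff_quadratic, e, mul_eq_zero, mul_eq_zero, sub_eq_zero, sub_eq_zero]
  norm_num

/-- The quadratic takes the value `-1` at `1`. This has to be excluded: for `x = 1` the metric is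
normal, the factor `x - 1` in the first variation vanishes, and every orbit is a geodesic. -/
theorem ne_one_of_isEinstein {x : ℝ} (h : IsEinstein x) : x ≠ 1 := by
  rintro rfl
  rw [isEinstein_iff_quadratic] at h
  norm_num at h

/-! ### The two bracket conditions as the bilinear system. -/

theorem toMat_eq_zero_iff (a : Coeff) :
    toMat a = 0 ↔ a = ⟨0, 0, 0, 0, 0, 0, 0, 0, 0, 0, 0, 0, 0, 0⟩ := by
  constructor
  · intro h
    rw [← coeff_toMat a, h]
    rfl
  · rintro rfl
    ext i j
    fin_cases i <;> fin_cases j <;> simp [toMat]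

/-- For `X = A + n` one has `[A + n, xA + n] = (1 - x)[A, n]`, which lies in `m₁₃ ⊕ m₂₃`. Its eight
coefficients are, up to sign, `1 - x` times the left sides of the system. -/
theorem projM_bracket_jensenOp_eq_zero_iff {x : ℝ} (hx : x ≠ 1) (a : Coeff) :
    projM ⁅toMat a, jensenOp x (toMat a)⁆ = 0 ↔ BilinearSystem a := by
  have h1 : 1 - x ≠ 0 := sub_ne_zero.2 hx.symm
  rw [jensenOp_toMat, projM_bracket_toMat, toMat_eq_zero_iff]
  simp only [bracketC, prodC, jensenC, Coeff.mk.injEq, BilinearSystem]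
  constructor
  · rintro ⟨-, -, -, h15, h16, -, -, h25, h26, -, h35, h36, h45, h46⟩
    refine ⟨?_, ?_, ?_, ?_, ?_, ?_, ?_, ?_⟩ <;> refine mul_left_cancel₀ h1 ?_
    · linear_combination -h25
    · linear_combination -h26
    · linear_combination -h35
    · linear_combination -h36
    · linear_combination -h45
    · linear_combination -h46
    · linear_combination h15
    · linear_combination h16
  · rintro ⟨h25, h26, h35, h36, h45, h46, h15, h16⟩
    refine ⟨by ring, by ring, by ring, ?_, ?_, by ring, by ring, ?_, ?_, by ring, ?_, ?_, ?_, ?_⟩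
    · linear_combination (1 - x) * h15
    · linear_combination (1 - x) * h16
    · linear_combination -(1 - x) * h25
    · linear_combination -(1 - x) * h26
    · linear_combination -(1 - x) * h35
    · linear_combination -(1 - x) * h36
    · linear_combination -(1 - x) * h45
    · linear_combination -(1 - x) * h46

theorem part_one_one_toMat (a : Coeff) :
    part 1 1 (toMat a) = toMat ⟨0, 0, 0, 0, 0, a.a23, a.a24, 0, 0, a.a34, 0, 0, 0, 0⟩ := by
  ext i j
  fin_cases i <;> fin_cases j <;> simp [part, blk, toMat]

theorem part_zero_one_toMat (a : Coeff) :
    part 0 1 (toMat a) = toMat ⟨a.a12, a.a13, a.a14, 0, 0, 0, 0, 0, 0, 0, 0, 0, 0, 0⟩ := by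
  ext i j
  fin_cases i <;> fin_cases j <;> simp [part, blk, toMat]

theorem part_zero_two_toMat (a : Coeff) :
    part 0 2 (toMat a) = toMat ⟨0, 0, 0, a.a15, a.a16, 0, 0, 0, 0, 0, 0, 0, 0, 0⟩ := by
  ext i j
  fin_cases i <;> fin_cases j <;> simp [part, blk, toMat]

theorem part_one_two_toMat (a : Coeff) :
    part 1 2 (toMat a) =
      toMat ⟨0, 0, 0, 0, 0, 0, 0, a.a25, a.a26, 0, a.a35, a.a36, a.a45, a.a46⟩ := by
  ext i j
  fin_cases i <;> fin_cases j <;> simp [part, blk, toMat]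

/-- Both `[m₂₃, so(3)]` and `[m₁₃, m₁₂]` lie in `m₂₃` and `[m₂₃, m₁₂]` lies in `m₁₃`, while `[m₁₃,
so(3)] = 0`. So the two conditions are the `m₂₃`- and `m₁₃`-components of `[n, A] = 0`: six
equations and two. -/
theorem bracket_parts_eq_zero_iff (a : Coeff) :
    (projM ⁅part 1 2 (toMat a), part 1 1 (toMat a)⁆
        + projM ⁅part 0 2 (toMat a), part 0 1 (toMat a)⁆ = 0 ∧
      projM ⁅part 1 2 (toMat a), part 0 1 (toMat a)⁆ = 0) ↔ BilinearSystem a := by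
  rw [part_one_one_toMat, part_zero_one_toMat, part_zero_two_toMat, part_one_two_toMat,
    projM_bracket_toMat, projM_bracket_toMat, projM_bracket_toMat, toMat_add, toMat_eq_zero_iff,
    toMat_eq_zero_iff]
  simp only [bracketC, prodC, addC, Coeff.mk.injEq, BilinearSystem]
  constructor
  · rintro ⟨⟨-, -, -, -, -, -, -, h25, h26, -, h35, h36, h45, h46⟩,
      -, -, -, h15, h16, -, -, -, -, -, -, -, -, -⟩
    refine ⟨?_, ?_, ?_, ?_, ?_, ?_, ?_, ?_⟩
    · linear_combination h25
    · linear_combination h26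
    · linear_combination h35
    · linear_combination h36
    · linear_combination h45
    · linear_combination h46
    · linear_combination -h15
    · linear_combination -h16
  · rintro ⟨h25, h26, h35, h36, h45, h46, h15, h16⟩
    refine ⟨⟨by ring, by ring, by ring, by ring, by ring, by ring, by ring, ?_, ?_, by ring,
      ?_, ?_, ?_, ?_⟩, by ring, by ring, by ring, ?_, ?_, by ring, by ring, by ring, by ring,
      by ring, by ring, by ring, by ring, by ring⟩
    · linear_combination h25
    · linear_combination h26
    · linear_combination h35
    · linear_combination h36
    · linear_combination h45
    · linear_combination h46
    · linear_combination -h15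
    · linear_combination -h16

/-! ### Solving the bilinear system. -/

/-- A solution lies in the first of the families 1, 4, 14, 15, 28, 36, 42 whose pivot is nonzero,
or in family 41 when the `so(4)`-part is regular. -/
theorem BilinearSystem.exists_mem_family {a : Coeff} (h : BilinearSystem a) :
    ∃ i, a ∈ family i := by
  obtain ⟨h1, h2, h3, h4, h5, h6, h7, h8⟩ := h
  -- This is the Pfaffian of the `so(4)`-part `A`.
  by_cases hp : a.a12 * a.a34 - a.a13 * a.a24 + a.a14 * a.a23 = 0
  swap
  -- Multiplying `A` by its Pfaffian adjoint gives the Pfaffian times the identity, up to sign. Its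
  -- entries are the coefficients in the combinations below, so the Pfaffian kills each coordinate
  -- of `n`.
  · have k : ∀ z, (a.a12 * a.a34 - a.a13 * a.a24 + a.a14 * a.a23) * z = 0 → z = 0 :=
      fun z hz => (mul_eq_zero.1 hz).resolve_left hp
    refine ⟨40, ?_, ?_, ?_, ?_, ?_, ?_, ?_, ?_⟩ <;> apply k
    · linear_combination a.a34 * h1 - a.a24 * h3 + a.a23 * h5
    · linear_combination a.a34 * h2 - a.a24 * h4 + a.a23 * h6
    · linear_combination a.a34 * h7 + a.a14 * h3 - a.a13 * h5
    · linear_combination a.a34 * h8 + a.a14 * h4 - a.a13 * h6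
    · linear_combination -a.a24 * h7 - a.a14 * h1 + a.a12 * h5
    · linear_combination -a.a24 * h8 - a.a14 * h2 + a.a12 * h6
    · linear_combination a.a23 * h7 + a.a13 * h1 - a.a12 * h3
    · linear_combination a.a23 * h8 + a.a13 * h2 - a.a12 * h4
  -- From here `A` has rank at most 2. The pivots are tried in the order `a34, a24, a23, a14, a13,
  -- a12`, and the vanishing of earlier ones simplifies the equations for the later ones. Equations
  -- not used in a case are consequences of the others.
  by_cases h34 : a.a34 = 0
  swap
  · refine ⟨0, h34, ?_, ?_, ?_, ?_, ?_⟩ <;> rw [eq_div_iff h34]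
    · linear_combination hp
    · linear_combination h5
    · linear_combination h6
    · linear_combination -h3
    · linear_combination -h4
  simp only [h34, mul_zero, sub_zero, add_zero, zero_sub] at hp h3 h4 h5 h6
  by_cases h24 : a.a24 = 0
  swap
  · refine ⟨3, h24, ?_, h34, ?_, ?_, ?_, ?_⟩ <;> rw [eq_div_iff h24]
    · linear_combination -hp
    · linear_combination h5
    · linear_combination h6
    · linear_combination -h1
    · linear_combination -h2
  simp only [h24, mul_zero, sub_zero, zero_add, neg_zero] at hp h1 h2 h5 h6
  by_cases h23 : a.a23 = 0
  swap
  · refine ⟨13, h23, (mul_eq_zero.1 hp).resolve_right h23, h24, h34, ?_, ?_, ?_, ?_⟩ <;>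
      rw [eq_div_iff h23]
    · linear_combination h3
    · linear_combination h4
    · linear_combination -h1
    · linear_combination -h2
  simp only [h23, mul_zero, sub_zero, zero_add] at h1 h2 h3 h4
  by_cases h14 : a.a14 = 0
  swap
  · refine ⟨14, h14, (mul_eq_zero.1 h5).resolve_right h14, (mul_eq_zero.1 h6).resolve_right h14,
      h23, h24, h34, ?_, ?_⟩ <;> rw [eq_div_iff h14]
    · linear_combination h7
    · linear_combination h8
  by_cases h13 : a.a13 = 0
  swap
  · refine ⟨27, h13, h14, (mul_eq_zero.1 h3).resolve_right h13,
      (mul_eq_zero.1 h4).resolve_right h13, h23, h24, h34, ?_, ?_⟩ <;> rw [eq_div_iff h13]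
    · linear_combination h7 - a.a45 * h14
    · linear_combination h8 - a.a46 * h14
  simp only [h13, h14, mul_zero, add_zero] at h7 h8
  by_cases h12 : a.a12 = 0
  swap
  · exact ⟨35, h13, h14, (mul_eq_zero.1 h1).resolve_right h12,
      (mul_eq_zero.1 h2).resolve_right h12, h23, h24, h34, (mul_eq_zero.1 h7).resolve_right h12,
      (mul_eq_zero.1 h8).resolve_right h12⟩
  · exact ⟨41, h12, h13, h14, h23, h24, h34⟩

theorem bilinearSystem_of_mem_family {a : Coeff} {i : Fin 42} (h : a ∈ family i) :
    BilinearSystem a := by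
  obtain ⟨a12, a13, a14, a15, a16, a23, a24, a25, a26, a34, a35, a36, a45, a46⟩ := a
  unfold BilinearSystem
  -- Weak head reduction turns membership in the `i`-th entry of the list into its defining
  -- conjunction; what remains is algebra with nonzero denominators.
  fin_cases i <;> (conv at h => whnf) <;> dsimp only at h ⊢ <;> grind

/-! ### The 42 families are pairwise distinct. -/

/-- Solutions of the system that separate the families. -/
def testPoint : Fin 17 → Coeff :=
  ![⟨0, 0, 0, 1, 0, 1, 0, 0, 0, 0, 0, 0, 0, 0⟩,
    ⟨0, 0, 0, 1, 0, 0, 1, 0, 0, 0, 0, 0, 0, 0⟩,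
    ⟨0, 1, 0, 0, 0, 1, 0, 0, 0, 0, 0, 0, 0, 0⟩,
    ⟨0, 0, 0, 1, 0, 0, 0, 0, 0, 0, 0, 0, 0, 0⟩,
    ⟨0, 1, 0, 0, 0, 0, 0, -1, 0, 0, 0, 0, 0, 0⟩,
    ⟨0, 0, 0, 0, 0, 1, 1, 1, 0, 1, -1, 0, 1, 0⟩,
    ⟨0, -1, 0, 0, 0, 1, 0, 0, 0, -1, 0, 0, 0, 0⟩,
    ⟨0, 0, -1, 0, 0, 0, 1, 0, 0, 0, 1, 0, 0, 0⟩,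
    ⟨0, 0, 1, 0, 0, 0, 0, 0, 0, 1, 0, 0, 0, 0⟩,
    ⟨0, 0, 0, 0, 0, -1, -1, 0, 0, -1, 0, 0, 0, 0⟩,
    ⟨0, 0, 0, 0, 1, 1, 1, 0, 0, 0, 0, 0, 0, 0⟩,
    ⟨0, 0, 0, 1, 0, 0, 0, -1, 0, 1, 0, 0, 0, 0⟩,
    ⟨1, 0, 0, 0, 0, 0, 1, 0, 0, 0, 0, 0, 0, 0⟩,
    ⟨-1, 0, 0, 0, 0, 1, 0, 0, 0, 0, 0, 0, 0, 0⟩,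
    ⟨0, 0, 0, 0, 0, 0, 0, 0, 0, 0, 0, 0, 0, 0⟩,
    ⟨0, 0, -1, 1, 0, 0, 1, 1, 0, 1, 0, 0, 0, 0⟩,
    ⟨0, 0, 0, 0, 0, 0, 0, 0, -1, 1, 0, 0, 0, 0⟩]

/-- The families through each test point. -/
def familiesThrough : Fin 17 → Finset (Fin 42) :=
  ![{13, 24, 25},
    {3, 9, 11, 12, 20, 22},
    {13, 24, 26, 32, 36, 39, 40},
    {38, 41},
    {27, 34},
    {0, 1, 2, 5},
    {0, 2, 7, 17, 36, 39, 40},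
    {3, 9, 10, 12, 19, 23},
    {0, 6, 8, 18, 37, 40},
    {0, 1, 2, 4, 5, 15, 28, 39, 40},
    {3, 9, 10, 11, 19, 20, 21, 30},
    {0, 2, 5, 6, 7, 8, 38},
    {3, 10, 11, 12, 21, 22, 23, 28, 31, 39, 40},
    {13, 25, 26, 33, 36, 39, 40},
    {34, 35, 36, 37, 38, 39, 40, 41},
    {0, 1, 4, 6, 16},
    {0, 2, 5, 6, 7, 8, 15, 18, 29, 38}]

-- A finite check of 17 × 42 memberships of explicit integer points, after which distinctness is
-- purely combinatorial.
set_option maxHeartbeats 4000000 in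
theorem testPoint_mem_family_iff (k : Fin 17) (i : Fin 42) :
    testPoint k ∈ family i ↔ i ∈ familiesThrough k := by
  revert i
  fin_cases k <;> intro i <;> simp only [testPoint, familiesThrough, Fin.mk_zero, Fin.mk_one,
    Fin.reduceFinMk, Matrix.cons_val] <;>
  fin_cases i <;> (conv => lhs; whnf) <;> norm_num <;> decide

/-- In the incidence table of points and families, no two families have the same set of points.
Equal families would have to. -/
theorem familiesThrough_separates :
    ∀ i j, (∀ k, i ∈ familiesThrough k ↔ j ∈ familiesThrough k) → i = j := by
  decide +kernel

theorem family_injective : Function.Injective family := by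
  intro i j h
  refine familiesThrough_separates i j fun k => ?_
  rw [← testPoint_mem_family_iff, h, testPoint_mem_family_iff]

/-! ### Curves of matrices, entry by entry -/

section MatrixCurves

variable {l m n : Type*}

/-- Entrywise derivative of a curve of matrices. -/
def HasEntryDerivAt (P : ℝ → Matrix m n ℝ) (P' : Matrix m n ℝ) (t : ℝ) : Prop :=
  ∀ i j, HasDerivAt (fun s => P s i j) (P' i j) t

theorem HasEntryDerivAt.transpose {P : ℝ → Matrix m n ℝ} {P' : Matrix m n ℝ} {t : ℝ}
    (h : HasEntryDerivAt P P' t) : HasEntryDerivAt (fun s => (P s)ᵀ) P'ᵀ t :=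
  fun i j => h j i

theorem hasEntryDerivAt_const (P : Matrix m n ℝ) (t : ℝ) :
    HasEntryDerivAt (fun _ => P) 0 t :=
  fun _ _ => hasDerivAt_const _ _

theorem HasEntryDerivAt.mul [Fintype m] {P : ℝ → Matrix l m ℝ} {P' : Matrix l m ℝ}
    {Q : ℝ → Matrix m n ℝ} {Q' : Matrix m n ℝ} {t : ℝ} (hP : HasEntryDerivAt P P' t)
    (hQ : HasEntryDerivAt Q Q' t) :
    HasEntryDerivAt (fun s => P s * Q s) (P' * Q t + P t * Q') t := by
  intro i j
  simp only [Matrix.mul_apply, Matrix.add_apply, ← Finset.sum_add_distrib]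
  exact HasDerivAt.fun_sum fun k _ => (hP i k).mul (hQ k j)

theorem HasEntryDerivAt.trace [Fintype n] {P : ℝ → Matrix n n ℝ} {P' : Matrix n n ℝ} {t : ℝ}
    (h : HasEntryDerivAt P P' t) : HasDerivAt (fun s => (P s).trace) P'.trace t :=
  HasDerivAt.fun_sum fun i _ => h i i

theorem HasEntryDerivAt.unique {P : ℝ → Matrix m n ℝ} {P' P'' : Matrix m n ℝ} {t : ℝ}
    (h : HasEntryDerivAt P P' t) (h' : HasEntryDerivAt P P'' t) : P' = P'' := by
  ext i j
  exact (h i j).unique (h' i j)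

theorem HasEntryDerivAt.trace_transpose_mul_self [Fintype m] [Fintype n] {P : ℝ → Matrix m n ℝ}
    {P' : Matrix m n ℝ} {t : ℝ} (h : HasEntryDerivAt P P' t) :
    HasDerivAt (fun s => ((P s)ᵀ * P s).trace) (2 * ((P t)ᵀ * P').trace) t := by
  convert (h.transpose.mul h).trace using 1
  rw [Matrix.trace_add, ← Matrix.trace_transpose (P'ᵀ * P t), Matrix.transpose_mul,
    Matrix.transpose_transpose]
  ring

theorem sum_sum_sq_eq_trace [Fintype m] [Fintype n] (M : Matrix m n ℝ) :
    ∑ i, ∑ j, M i j ^ 2 = (Mᵀ * M).trace := by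
  rw [Finset.sum_comm]
  simp [Matrix.trace, Matrix.mul_apply, sq]

end MatrixCurves

/-! ### One-parameter groups of matrices. -/

section Exponential

variable {n : Type*} [Fintype n] [DecidableEq n]

-- A norm on matrices serves only to differentiate `exp`; reading off an entry is continuous and
-- linear, so the conclusion is free of it.
open scoped Matrix.Norms.Operator in
theorem hasEntryDerivAt_exp_smul (X : Matrix n n ℝ) (t : ℝ) :
    HasEntryDerivAt (fun s => NormedSpace.exp (s • X)) (NormedSpace.exp (t • X) * X) t := by
  intro i j
  have h := hasDerivAt_exp_smul_const (𝕂 := ℝ) X t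
  exact (LinearMap.toContinuousLinearMap
    (Matrix.entryLinearMap ℝ ℝ i j)).hasFDerivAt.comp_hasDerivAt t h

open scoped Matrix.Norms.Operator in
theorem contDiff_exp_smul_entry (X : Matrix n n ℝ) (i j : n) :
    ContDiff ℝ ∞ fun s : ℝ => NormedSpace.exp (s • X) i j := by
  have h : ContDiff ℝ ∞ (NormedSpace.exp : Matrix n n ℝ → Matrix n n ℝ) :=
    AnalyticOnNhd.contDiff fun x _ => NormedSpace.exp_analytic x
  have h2 : ContDiff ℝ ∞ fun s : ℝ => NormedSpace.exp (s • X) :=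
    h.comp (contDiff_id.smul contDiff_const)
  exact (LinearMap.toContinuousLinearMap (Matrix.entryLinearMap ℝ ℝ i j)).contDiff.comp h2

theorem exp_transpose_mul_exp {X : Matrix n n ℝ} (hX : Xᵀ = -X) (t : ℝ) :
    (NormedSpace.exp (t • X))ᵀ * NormedSpace.exp (t • X) = 1 := by
  rw [← Matrix.exp_transpose, ← Matrix.exp_add_of_commute, Matrix.transpose_smul, hX]
  · simp
  · rw [Matrix.transpose_smul, hX, smul_neg]
    exact (Commute.refl _).neg_left

end Exponential

/-! ### Differentiation under the integral sign -/

theorem hasDerivAt_fst_of_contDiff {f : ℝ × ℝ → ℝ} (hf : ContDiff ℝ ∞ f) (s t : ℝ) :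
    HasDerivAt (fun u => f (u, t)) (fderiv ℝ f (s, t) (1, 0)) s := by
  have h1 := (hf.differentiable (by simp) (s, t)).hasFDerivAt
  exact h1.comp_hasDerivAt s ((hasDerivAt_id s).prodMk (hasDerivAt_const s t))

theorem hasDerivAt_snd_of_contDiff {f : ℝ × ℝ → ℝ} (hf : ContDiff ℝ ∞ f) (s t : ℝ) :
    HasDerivAt (fun u => f (s, u)) (fderiv ℝ f (s, t) (0, 1)) t := by
  have h1 := (hf.differentiable (by simp) (s, t)).hasFDerivAt
  exact h1.comp_hasDerivAt t ((hasDerivAt_const t s).prodMk (hasDerivAt_id t))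

theorem contDiff_fderiv_apply_const {f : ℝ × ℝ → ℝ} (hf : ContDiff ℝ ∞ f) (v : ℝ × ℝ) :
    ContDiff ℝ ∞ fun z => fderiv ℝ f z v :=
  (hf.fderiv_right (m := ∞) (by simp)).clm_apply contDiff_const

/-- Needed to exchange the derivatives in the variation parameter `s` and the time `t`. -/
theorem fderiv_fderiv_comm {f : ℝ × ℝ → ℝ} (hf : ContDiff ℝ ∞ f) (z v w : ℝ × ℝ) :
    fderiv ℝ (fun y => fderiv ℝ f y v) z w = fderiv ℝ (fun y => fderiv ℝ f y w) z v := by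
  have hd : DifferentiableAt ℝ (fderiv ℝ f) z :=
    (hf.fderiv_right (m := ∞) (by simp)).differentiable (by simp) z
  rw [fderiv_clm_apply hd (differentiableAt_const v),
    fderiv_clm_apply hd (differentiableAt_const w)]
  have hs : IsSymmSndFDerivAt ℝ f z :=
    hf.contDiffAt.isSymmSndFDerivAt (by
      rw [minSmoothness_of_isRCLikeNormedField]
      exact WithTop.coe_le_coe.2 (le_top : (2 : ℕ∞) ≤ ⊤))
  simpa using hs w v

/-- The dominating function is a constant: the `s`-derivative is continuous, hence bounded on the
compact product of the unit ball around `s₀` and the interval. -/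
theorem hasDerivAt_intervalIntegral_of_contDiff {f : ℝ × ℝ → ℝ} (hf : ContDiff ℝ ∞ f)
    (a b s₀ : ℝ) :
    HasDerivAt (fun s => ∫ t in a..b, f (s, t)) (∫ t in a..b, fderiv ℝ f (s₀, t) (1, 0)) s₀ := by
  have hc : Continuous fun z => fderiv ℝ f z (1, 0) :=
    (contDiff_fderiv_apply_const hf (1, 0)).continuous
  obtain ⟨C, hC⟩ := (isCompact_closedBall s₀ 1 |>.prod (isCompact_uIcc (a := a) (b := b))
    ).exists_bound_of_continuousOn hc.continuousOn
  refine (intervalIntegral.hasDerivAt_integral_of_dominated_loc_of_deriv_le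
    (s := Metric.closedBall s₀ 1) (bound := fun _ => C)
    (F' := fun s t => fderiv ℝ f (s, t) (1, 0)) (Metric.closedBall_mem_nhds s₀ one_pos)
    (.of_forall fun s => (hf.continuous.comp (by fun_prop)).aestronglyMeasurable)
    ((hf.continuous.comp (by fun_prop)).intervalIntegrable _ _)
    (hc.comp (by fun_prop : Continuous fun t : ℝ => (s₀, t))).aestronglyMeasurable
    (.of_forall fun t ht s hs => hC (s, t) ⟨hs, Set.uIoc_subset_uIcc ht⟩)
    (by simp) (.of_forall fun t _ s _ => hasDerivAt_fst_of_contDiff hf s t)).2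

/-! ### The first variation of the energy along an orbit -/

theorem metricSq_eq_trace (x : ℝ) (p w : Matrix (Fin 6) (Fin 4) ℝ) :
    metricSq x p w = 8 * (wᵀ * w).trace + 4 * (x - 2) * ((pᵀ * w)ᵀ * (pᵀ * w)).trace := by
  rw [metricSq, sum_sum_sq_eq_trace, sum_sum_sq_eq_trace]
  ring

theorem hasDerivAt_metricSq (x : ℝ) {P W : ℝ → Matrix (Fin 6) (Fin 4) ℝ}
    {P' W' : Matrix (Fin 6) (Fin 4) ℝ} {s : ℝ} (hP : HasEntryDerivAt P P' s)
    (hW : HasEntryDerivAt W W' s) :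
    HasDerivAt (fun s => metricSq x (P s) (W s))
      (16 * ((W s)ᵀ * W').trace
        + 8 * (x - 2) * (((P s)ᵀ * W s)ᵀ * (P'ᵀ * W s + (P s)ᵀ * W')).trace) s := by
  simp only [metricSq_eq_trace]
  have h1 := hW.trace_transpose_mul_self.const_mul 8
  have h2 := (hP.transpose.mul hW).trace_transpose_mul_self.const_mul (4 * (x - 2))
  exact (h1.fun_add h2).congr_deriv (by ring)

/-- The generator of the tangential part of an orbit. -/
def tangentBlock (X : Matrix (Fin 6) (Fin 6) ℝ) : Matrix (Fin 4) (Fin 4) ℝ :=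
  originᵀ * X * origin

/-- The component of `[X, ΛX]` normal to the span of the frame, up to a factor. -/
def normalDefect (X : Matrix (Fin 6) (Fin 6) ℝ) : Matrix (Fin 6) (Fin 4) ℝ :=
  (X * origin - origin * tangentBlock X) * tangentBlock X

theorem origin_transpose_mul_origin : originᵀ * origin = 1 := by
  ext i j
  fin_cases i <;> fin_cases j <;> simp [origin, Matrix.mul_apply, Fin.sum_univ_succ]

theorem origin_mul_transpose :
    (1 : Matrix (Fin 6) (Fin 6) ℝ) - origin * originᵀ = Matrix.diagonal ![0, 0, 0, 0, 1, 1] := by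
  ext i j
  fin_cases i <;> fin_cases j <;> simp [origin, Matrix.mul_apply, Fin.sum_univ_succ]

/-- This is where membership in `m`, and not merely in `so(6)`, enters: the lower right block of `X`
vanishes. -/
theorem normal_block_eq_zero {X : Matrix (Fin 6) (Fin 6) ℝ} (hX : X ∈ mSpace) :
    (1 - origin * originᵀ) * X * (1 - origin * originᵀ) = 0 := by
  rw [← toMat_coeff hX, origin_mul_transpose]
  ext i j
  rw [Matrix.mul_diagonal, Matrix.diagonal_mul]
  fin_cases i <;> fin_cases j <;> simp [toMat]

theorem tangentBlock_transpose {X : Matrix (Fin 6) (Fin 6) ℝ} (hX : Xᵀ = -X) :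
    (tangentBlock X)ᵀ = -tangentBlock X := by
  rw [tangentBlock, Matrix.transpose_mul, Matrix.transpose_mul, hX, Matrix.transpose_transpose]
  simp [Matrix.mul_assoc]

theorem origin_transpose_mul_normalDefect (X : Matrix (Fin 6) (Fin 6) ℝ) :
    originᵀ * normalDefect X = 0 := by
  rw [normalDefect, ← Matrix.mul_assoc, Matrix.mul_sub, ← Matrix.mul_assoc, ← Matrix.mul_assoc,
    origin_transpose_mul_origin, Matrix.one_mul, ← tangentBlock, sub_self, Matrix.zero_mul]

/-- The Euler-Lagrange expression splits into a symmetric tangential part, which is orthogonal to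
the Stiefel manifold, and a multiple of the normal defect. -/
theorem eulerLagrange_decomposition {X : Matrix (Fin 6) (Fin 6) ℝ} (hX : X ∈ mSpace) (x : ℝ) :
    ∃ S : Matrix (Fin 4) (Fin 4) ℝ, Sᵀ = S ∧
      X * X * origin + (x - 2) • (X * origin * tangentBlock X)
        = origin * S + (x - 1) • normalDefect X := by
  have hs := ((mem_mSpace_iff X).1 hX).1
  have hA := tangentBlock_transpose hs
  set N := X * origin - origin * tangentBlock X with hN
  have hN' : N = (1 - origin * originᵀ) * X * origin := by
    rw [hN, tangentBlock]
    simp only [Matrix.sub_mul, Matrix.one_mul, Matrix.mul_assoc]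
  have hproj : (1 - origin * originᵀ) * (1 - origin * originᵀ) = 1 - origin * originᵀ := by
    have : origin * originᵀ * (origin * originᵀ) = origin * originᵀ := by
      rw [Matrix.mul_assoc, ← Matrix.mul_assoc originᵀ, origin_transpose_mul_origin,
        Matrix.one_mul]
    simp only [Matrix.sub_mul, Matrix.mul_sub, Matrix.one_mul, Matrix.mul_one, this]
    abel
  -- `N` has values in the span of `e₅, e₆`, and `X` maps that span into the span of the frame.
  have hXN : X * N = origin * (originᵀ * X * N) := by
    have h0 : (1 - origin * originᵀ) * X * N = 0 := by
      rw [hN']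
      calc (1 - origin * originᵀ) * X * ((1 - origin * originᵀ) * X * origin)
          = (1 - origin * originᵀ) * X
            * ((1 - origin * originᵀ) * (1 - origin * originᵀ) * X * origin) := by rw [hproj]
        _ = ((1 - origin * originᵀ) * X * (1 - origin * originᵀ))
            * ((1 - origin * originᵀ) * X * origin) := by simp only [Matrix.mul_assoc]
        _ = 0 := by rw [normal_block_eq_zero hX, Matrix.zero_mul]
    rw [Matrix.sub_mul, Matrix.sub_mul, Matrix.one_mul, sub_eq_zero] at h0
    rw [h0]
    simp only [Matrix.mul_assoc]
  -- Substituting `X o = o A + N` gives `(x - 1)(o A² + N A) + X N`, and `X N = o (oᵀ X N)`. Both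
  -- `A²` and `oᵀ X N` are symmetric, as each contains two skew factors.
  refine ⟨(x - 1) • (tangentBlock X * tangentBlock X) + originᵀ * X * N, ?_, ?_⟩
  · rw [Matrix.transpose_add, Matrix.transpose_smul, Matrix.transpose_mul, hA]
    congr 1
    · simp
    · rw [hN']
      simp only [Matrix.transpose_mul, Matrix.transpose_sub, Matrix.transpose_one,
        Matrix.transpose_transpose, hs, Matrix.mul_assoc]
      simp only [Matrix.neg_mul, Matrix.mul_neg, neg_neg]
  · have hXo : X * origin = origin * tangentBlock X + N := by rw [hN]; abel
    have hd : normalDefect X = N * tangentBlock X := rfl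
    rw [Matrix.mul_add, ← hXN, hd, Matrix.mul_assoc X X, hXo, Matrix.mul_add, ← Matrix.mul_assoc X,
      hXo, Matrix.add_mul]
    simp only [Matrix.mul_smul, Matrix.mul_assoc, smul_add]
    module

theorem orbit_hasEntryDerivAt (X : Matrix (Fin 6) (Fin 6) ℝ) (M : Matrix (Fin 6) (Fin 4) ℝ)
    (t : ℝ) :
    HasEntryDerivAt (fun s => NormedSpace.exp (s • X) * M) (NormedSpace.exp (t • X) * (X * M))
      t := by
  have := (hasEntryDerivAt_exp_smul X t).mul (hasEntryDerivAt_const M t)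
  simpa [Matrix.mul_assoc] using this

theorem exp_mul_transpose_mul {X : Matrix (Fin 6) (Fin 6) ℝ} (hX : Xᵀ = -X) (t : ℝ)
    {k l : Type*} [Fintype k] [Fintype l] (M : Matrix (Fin 6) k ℝ) (N : Matrix (Fin 6) l ℝ) :
    (NormedSpace.exp (t • X) * M)ᵀ * (NormedSpace.exp (t • X) * N) = Mᵀ * N := by
  rw [Matrix.transpose_mul, Matrix.mul_assoc, ← Matrix.mul_assoc _ (NormedSpace.exp (t • X)),
    exp_transpose_mul_exp hX, Matrix.one_mul]

theorem orbit_mem_stiefel {X : Matrix (Fin 6) (Fin 6) ℝ} (hX : Xᵀ = -X) (t : ℝ) :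
    orbit X t ∈ stiefel := by
  change _ = _
  rw [orbit, exp_mul_transpose_mul hX, origin_transpose_mul_origin]

theorem orbit_contDiff (X : Matrix (Fin 6) (Fin 6) ℝ) (i : Fin 6) (j : Fin 4) :
    ContDiff ℝ ∞ fun t => orbit X t i j := by
  simp only [orbit, Matrix.mul_apply]
  exact ContDiff.sum fun k _ => (contDiff_exp_smul_entry X i k).mul contDiff_const

/-- The first variation of the integrand of the energy is an exact derivative plus the
Euler-Lagrange term. -/
theorem first_variation_integrand {A : Matrix (Fin 4) (Fin 4) ℝ} (hA : Aᵀ = -A) (x : ℝ)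
    (P W W' V V' : Matrix (Fin 6) (Fin 4) ℝ) :
    8 * (Wᵀ * V').trace + 4 * (x - 2) * (Aᵀ * (Vᵀ * W + Pᵀ * V')).trace
      = (8 * (W'ᵀ * V + Wᵀ * V').trace + 4 * (x - 2) * (Aᵀ * (Wᵀ * V + Pᵀ * V')).trace)
        - 8 * ((W' + (x - 2) • (W * A))ᵀ * V).trace := by
  have h1 : (A * (Vᵀ * W)).trace = -(A * (Wᵀ * V)).trace := by
    rw [← Matrix.trace_transpose, Matrix.transpose_mul, Matrix.transpose_mul, hA,
      Matrix.transpose_transpose, Matrix.mul_neg, Matrix.trace_neg, Matrix.trace_mul_comm]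
  simp only [Matrix.mul_add, Matrix.trace_add, Matrix.transpose_add, Matrix.transpose_smul,
    Matrix.transpose_mul, hA, Matrix.add_mul, Matrix.smul_mul, Matrix.trace_smul, Matrix.neg_mul,
    Matrix.trace_neg, smul_eq_mul, Matrix.mul_assoc, h1]
  ring

theorem trace_mul_eq_zero_of_symm_of_skew {n : Type*} [Fintype n] {S K : Matrix n n ℝ}
    (hS : Sᵀ = S) (hK : Kᵀ = -K) : (S * K).trace = 0 := by
  have h := Matrix.trace_transpose (S * K)
  rw [Matrix.transpose_mul, hS, hK, Matrix.neg_mul, Matrix.trace_neg, Matrix.trace_mul_comm] at h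
  linarith

/-- The variation vector field of a variation. -/
def variationField (F : ℝ → ℝ → Matrix (Fin 6) (Fin 4) ℝ) (t : ℝ) : Matrix (Fin 6) (Fin 4) ℝ :=
  Matrix.of fun i j => deriv (fun s => F s t i j) 0

theorem HasEntryDerivAt.velocity_eq {c : ℝ → Matrix (Fin 6) (Fin 4) ℝ}
    {c' : Matrix (Fin 6) (Fin 4) ℝ} {t : ℝ} (h : HasEntryDerivAt c c' t) : velocity c t = c' := by
  ext i j
  exact (h i j).deriv

theorem velocity_orbit (X : Matrix (Fin 6) (Fin 6) ℝ) (t : ℝ) :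
    velocity (orbit X) t = NormedSpace.exp (t • X) * (X * origin) :=
  (orbit_hasEntryDerivAt X origin t).velocity_eq

/-! ### Smooth two-parameter families of frames. -/

section SmoothFamilies

variable {F : ℝ → ℝ → Matrix (Fin 6) (Fin 4) ℝ}

theorem hasEntryDerivAt_fst (hF : ∀ i j, ContDiff ℝ ∞ fun z : ℝ × ℝ => F z.1 z.2 i j) (t : ℝ) :
    HasEntryDerivAt (fun s => F s t) (variationField F t) 0 :=
  fun i j => (hasDerivAt_fst_of_contDiff (hF i j) 0 t).differentiableAt.hasDerivAt

theorem velocity_apply_eq_fderiv (hF : ∀ i j, ContDiff ℝ ∞ fun z : ℝ × ℝ => F z.1 z.2 i j)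
    (s t : ℝ) (i : Fin 6) (j : Fin 4) :
    velocity (F s) t i j = fderiv ℝ (fun z : ℝ × ℝ => F z.1 z.2 i j) (s, t) (0, 1) :=
  (hasDerivAt_snd_of_contDiff (hF i j) s t).deriv

theorem variationField_apply_eq_fderiv
    (hF : ∀ i j, ContDiff ℝ ∞ fun z : ℝ × ℝ => F z.1 z.2 i j) (t : ℝ) (i : Fin 6) (j : Fin 4) :
    variationField F t i j = fderiv ℝ (fun z : ℝ × ℝ => F z.1 z.2 i j) (0, t) (1, 0) :=
  (hasDerivAt_fst_of_contDiff (hF i j) 0 t).deriv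

theorem contDiff_velocity (hF : ∀ i j, ContDiff ℝ ∞ fun z : ℝ × ℝ => F z.1 z.2 i j) (i : Fin 6)
    (j : Fin 4) : ContDiff ℝ ∞ fun z : ℝ × ℝ => velocity (F z.1) z.2 i j := by
  simp only [velocity_apply_eq_fderiv hF]
  exact contDiff_fderiv_apply_const (hF i j) (0, 1)

theorem hasEntryDerivAt_variationField
    (hF : ∀ i j, ContDiff ℝ ∞ fun z : ℝ × ℝ => F z.1 z.2 i j) (t : ℝ) :
    HasEntryDerivAt (variationField F) (velocity (variationField F) t) t := by
  intro i j
  simp only [velocity, Matrix.of_apply, variationField_apply_eq_fderiv hF]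
  exact (hasDerivAt_snd_of_contDiff
    (contDiff_fderiv_apply_const (hF i j) (1, 0)) 0 t).differentiableAt.hasDerivAt

/-- The velocity of the variation field is the variation of the velocity. -/
theorem hasEntryDerivAt_velocity (hF : ∀ i j, ContDiff ℝ ∞ fun z : ℝ × ℝ => F z.1 z.2 i j)
    (t : ℝ) : HasEntryDerivAt (fun s => velocity (F s) t) (velocity (variationField F) t) 0 := by
  intro i j
  have h1 := hasDerivAt_fst_of_contDiff (contDiff_fderiv_apply_const (hF i j) (0, 1)) 0 t
  have h2 := hasDerivAt_snd_of_contDiff (contDiff_fderiv_apply_const (hF i j) (1, 0)) 0 t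
  have h3 : velocity (variationField F) t i j
      = fderiv ℝ (fun z => fderiv ℝ (fun z : ℝ × ℝ => F z.1 z.2 i j) z (0, 1)) (0, t) (1, 0) := by
    simp only [velocity, Matrix.of_apply, variationField_apply_eq_fderiv hF]
    rw [h2.deriv, fderiv_fderiv_comm (hF i j)]
  rw [h3]
  simpa only [velocity_apply_eq_fderiv hF] using h1

theorem contDiff_metricSq_velocity (hF : ∀ i j, ContDiff ℝ ∞ fun z : ℝ × ℝ => F z.1 z.2 i j)
    (x : ℝ) : ContDiff ℝ ∞ fun z : ℝ × ℝ => metricSq x (F z.1 z.2) (velocity (F z.1) z.2) := by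
  have hv := contDiff_velocity hF
  have hp : ∀ i j, ContDiff ℝ ∞ fun z : ℝ × ℝ => ((F z.1 z.2)ᵀ * velocity (F z.1) z.2) i j := by
    intro i j
    simp only [Matrix.mul_apply, Matrix.transpose_apply]
    exact ContDiff.sum fun k _ => (hF k i).mul (hv k j)
  have hs : ContDiff ℝ ∞ fun z : ℝ × ℝ =>
      ∑ i, ∑ j, ((F z.1 z.2)ᵀ * velocity (F z.1) z.2) i j ^ 2 :=
    ContDiff.sum fun i _ => ContDiff.sum fun j _ => (hp i j).pow 2
  have hw : ContDiff ℝ ∞ fun z : ℝ × ℝ => ∑ i, ∑ j, velocity (F z.1) z.2 i j ^ 2 :=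
    ContDiff.sum fun i _ => ContDiff.sum fun j _ => (hv i j).pow 2
  exact contDiff_const.mul ((contDiff_const.mul hs).add (contDiff_const.mul (hw.sub hs)))

end SmoothFamilies

/-- The Euler-Lagrange term along an orbit, paired with a tangent vector of the Stiefel
manifold. -/
theorem eulerLagrange_orbit {X : Matrix (Fin 6) (Fin 6) ℝ} (hX : X ∈ mSpace) (x t : ℝ)
    {V : Matrix (Fin 6) (Fin 4) ℝ} (hV : ((orbit X t)ᵀ * V)ᵀ = -((orbit X t)ᵀ * V)) :
    ((NormedSpace.exp (t • X) * (X * (X * origin))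
        + (x - 2) • (NormedSpace.exp (t • X) * (X * origin) * tangentBlock X))ᵀ * V).trace
      = (x - 1) * ((NormedSpace.exp (t • X) * normalDefect X)ᵀ * V).trace := by
  obtain ⟨S, hS, hD⟩ := eulerLagrange_decomposition hX x
  have e : NormedSpace.exp (t • X) * (X * (X * origin))
        + (x - 2) • (NormedSpace.exp (t • X) * (X * origin) * tangentBlock X)
      = orbit X t * S + (x - 1) • (NormedSpace.exp (t • X) * normalDefect X) := by
    have h := congrArg (NormedSpace.exp (t • X) * ·) hD
    simpa only [orbit, Matrix.mul_add, Matrix.mul_smul, Matrix.mul_assoc] using h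
  rw [e, Matrix.transpose_add, Matrix.add_mul, Matrix.trace_add, Matrix.transpose_smul,
    Matrix.smul_mul, Matrix.trace_smul, smul_eq_mul, Matrix.transpose_mul, hS, Matrix.mul_assoc,
    trace_mul_eq_zero_of_symm_of_skew hS hV, zero_add]

/-- The first variation formula for the energy of an orbit. -/
theorem IsVariation.hasDerivAt_energy {X : Matrix (Fin 6) (Fin 6) ℝ} (hX : X ∈ mSpace) {a b : ℝ}
    {F : ℝ → ℝ → Matrix (Fin 6) (Fin 4) ℝ} (h : IsVariation (orbit X) a b F) (x : ℝ) :
    HasDerivAt (fun s => energy x a b (F s))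
      (-(8 * (x - 1)) * ∫ t in a..b,
        ((NormedSpace.exp (t • X) * normalDefect X)ᵀ * variationField F t).trace) 0 := by
  obtain ⟨hst, hF, h0, hab⟩ := h
  have hs := ((mem_mSpace_iff X).1 hX).1
  have hL := contDiff_metricSq_velocity hF x
  have hE := (hasDerivAt_intervalIntegral_of_contDiff hL a b 0).const_mul (1 / 2 : ℝ)
  refine hE.congr_deriv ?_
  have hF0 : F 0 = orbit X := funext h0
  -- As `exp(tX)` is orthogonal, the tangential part of the velocity does not depend on `t`.
  have hA : ∀ t, (orbit X t)ᵀ * velocity (orbit X) t = tangentBlock X := fun t => by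
    rw [velocity_orbit, orbit, exp_mul_transpose_mul hs, tangentBlock, Matrix.mul_assoc]
  -- Differentiate `Fᵀ F = 1` in the variation parameter.
  have hV : ∀ t, ((orbit X t)ᵀ * variationField F t)ᵀ = -((orbit X t)ᵀ * variationField F t) := by
    intro t
    have h1 := hasEntryDerivAt_fst hF t
    have h2 := h1.transpose.mul h1
    have h3 : (fun s => (F s t)ᵀ * F s t) = fun _ => 1 := funext fun s => hst s t
    rw [h3] at h2
    have h4 := h2.unique (hasEntryDerivAt_const _ _)
    rw [h0] at h4
    rw [Matrix.transpose_mul, Matrix.transpose_transpose]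
    exact eq_neg_of_add_eq_zero_left h4
  set E : ℝ → ℝ := fun t =>
    ((NormedSpace.exp (t • X) * normalDefect X)ᵀ * variationField F t).trace with hEdef
  set I : ℝ → ℝ := fun t => fderiv ℝ (fun z : ℝ × ℝ =>
    metricSq x (F z.1 z.2) (velocity (F z.1) z.2)) (0, t) (1, 0) with hIdef
  have hI : ∀ t, I t = 16 * ((velocity (orbit X) t)ᵀ * velocity (variationField F) t).trace
      + 8 * (x - 2) * ((tangentBlock X)ᵀ * ((variationField F t)ᵀ * velocity (orbit X) t
        + (orbit X t)ᵀ * velocity (variationField F) t)).trace := by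
    intro t
    have h1 := hasDerivAt_metricSq x (hasEntryDerivAt_fst hF t) (hasEntryDerivAt_velocity hF t)
    have h2 := (hasDerivAt_fst_of_contDiff hL 0 t).unique h1
    rw [hF0, hA] at h2
    exact h2
  -- Integration by parts through an explicit antiderivative: the momentum paired with the variation
  -- field. It vanishes where the end points are fixed.
  have hphi : ∀ t, HasDerivAt (fun t => 8 * ((velocity (orbit X) t)ᵀ * variationField F t).trace
      + 4 * (x - 2) * ((tangentBlock X)ᵀ * ((orbit X t)ᵀ * variationField F t)).trace)
      (1 / 2 * I t + 8 * (x - 1) * E t) t := by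
    intro t
    have hP : HasEntryDerivAt (orbit X) (velocity (orbit X) t) t := by
      rw [velocity_orbit]
      exact orbit_hasEntryDerivAt X origin t
    have hW : HasEntryDerivAt (velocity (orbit X))
        (NormedSpace.exp (t • X) * (X * (X * origin))) t := by
      rw [funext (velocity_orbit X)]
      exact orbit_hasEntryDerivAt X _ t
    have hVV := hasEntryDerivAt_variationField hF t
    have h1 := (hW.transpose.mul hVV).trace.const_mul 8
    have h2 := ((hasEntryDerivAt_const (tangentBlock X)ᵀ t).mul
      (hP.transpose.mul hVV)).trace.const_mul (4 * (x - 2))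
    refine (h1.fun_add h2).congr_deriv ?_
    have h3 := first_variation_integrand (tangentBlock_transpose hs) x (orbit X t)
      (velocity (orbit X) t) (NormedSpace.exp (t • X) * (X * (X * origin))) (variationField F t)
      (velocity (variationField F) t)
    have h4 := eulerLagrange_orbit hX x t (hV t)
    rw [← velocity_orbit] at h4
    rw [Matrix.zero_mul, zero_add, hI]
    linear_combination -h3 + 8 * h4
  have hIc : Continuous I :=
    (contDiff_fderiv_apply_const hL (1, 0)).continuous.comp (by fun_prop)
  have hEc : Continuous E := by
    refine continuous_iff_continuousAt.2 fun t => HasDerivAt.continuousAt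
      (((orbit_hasEntryDerivAt X (normalDefect X) t).transpose.mul
        (hasEntryDerivAt_variationField hF t)).trace)
  have hend : ∀ c, (∀ s, F s c = orbit X c) → variationField F c = 0 := by
    intro c hc
    ext i j
    simp [variationField, hc]
  have hint := intervalIntegral.integral_eq_sub_of_hasDerivAt (a := a) (b := b)
    (fun t _ => hphi t) (Continuous.intervalIntegrable (by fun_prop) _ _)
  rw [hend a fun s => (hab s).1, hend b fun s => (hab s).2,
    intervalIntegral.integral_add (Continuous.intervalIntegrable (by fun_prop) _ _)
      (Continuous.intervalIntegrable (by fun_prop) _ _),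
    intervalIntegral.integral_const_mul, intervalIntegral.integral_const_mul] at hint
  simp only [Matrix.mul_zero, Matrix.trace_zero, mul_zero, add_zero, sub_zero] at hint
  linear_combination hint

/-! ### The test variation and the geodesic criterion. -/

/-- The variation of an orbit in the direction of its normal defect. -/
def defectVariation (X : Matrix (Fin 6) (Fin 6) ℝ) (s t : ℝ) : Matrix (Fin 6) (Fin 4) ℝ :=
  NormedSpace.exp (t • X) * (NormedSpace.exp ((s * (t * (1 - t))) •
    (normalDefect X * originᵀ - origin * (normalDefect X)ᵀ)) * origin)

theorem defectGenerator_transpose (X : Matrix (Fin 6) (Fin 6) ℝ) :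
    (normalDefect X * originᵀ - origin * (normalDefect X)ᵀ)ᵀ
      = -(normalDefect X * originᵀ - origin * (normalDefect X)ᵀ) := by
  simp [Matrix.transpose_sub, Matrix.transpose_mul]

theorem defectVariation_isVariation {X : Matrix (Fin 6) (Fin 6) ℝ} (hX : X ∈ mSpace) :
    IsVariation (orbit X) 0 1 (defectVariation X) := by
  have hs := ((mem_mSpace_iff X).1 hX).1
  refine ⟨fun s t => ?_, fun i j => ?_, fun t => ?_, fun s => ⟨?_, ?_⟩⟩
  · change _ = _
    rw [defectVariation, exp_mul_transpose_mul hs,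
      exp_mul_transpose_mul (defectGenerator_transpose X), origin_transpose_mul_origin]
  · simp only [defectVariation, Matrix.mul_apply]
    refine ContDiff.sum fun k _ => ((contDiff_exp_smul_entry X i k).comp contDiff_snd).mul
      (ContDiff.sum fun l _ => ContDiff.mul ?_ contDiff_const)
    exact (contDiff_exp_smul_entry _ k l).comp
      (contDiff_fst.mul (contDiff_snd.mul (contDiff_const.sub contDiff_snd)))
  all_goals simp [defectVariation, orbit]

theorem variationField_defectVariation (X : Matrix (Fin 6) (Fin 6) ℝ) (t : ℝ) :
    variationField (defectVariation X) t
      = (t * (1 - t)) • (NormedSpace.exp (t • X) * normalDefect X) := by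
  have h := hasEntryDerivAt_exp_smul (normalDefect X * originᵀ - origin * (normalDefect X)ᵀ) 0
  have hd : HasEntryDerivAt (fun s => NormedSpace.exp ((s * (t * (1 - t))) •
      (normalDefect X * originᵀ - origin * (normalDefect X)ᵀ)))
      ((t * (1 - t)) • (normalDefect X * originᵀ - origin * (normalDefect X)ᵀ)) 0 := by
    intro i j
    have h1 : HasDerivAt (fun s : ℝ => s * (t * (1 - t))) (t * (1 - t)) 0 := by
      simpa using (hasDerivAt_id (0 : ℝ)).mul_const (t * (1 - t))
    have h2 := h i j
    -- The point `0` must appear as the value of `s ↦ s t (1 - t)` at `s = 0` for the chain rule to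
    -- apply.
    rw [← zero_mul (t * (1 - t))] at h2
    have h3 := HasDerivAt.comp (0 : ℝ) h2 h1
    simp only [zero_mul, zero_smul, NormedSpace.exp_zero, Matrix.one_mul] at h3
    exact h3.congr_deriv (by rw [Matrix.smul_apply, smul_eq_mul, mul_comm])
  have h4 := (hasEntryDerivAt_const (NormedSpace.exp (t • X)) 0).mul
    (hd.mul (hasEntryDerivAt_const origin 0))
  have h5 : variationField (defectVariation X) t = _ := HasEntryDerivAt.velocity_eq h4
  rw [h5]
  -- With this and `oᵀ o = 1`, the generator `D oᵀ - o Dᵀ` sends `o` to `D`.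
  have h6 : (normalDefect X)ᵀ * origin = 0 := by
    rw [← Matrix.transpose_transpose origin, ← Matrix.transpose_mul,
      origin_transpose_mul_normalDefect, Matrix.transpose_zero]
  simp [Matrix.sub_mul, Matrix.mul_assoc, origin_transpose_mul_origin, h6]

/-- If the defect `D` vanishes, so does the first variation. Conversely, the test variation has
derivative `-(4/3)(x - 1)|D|²`, where `4/3 = 8 ∫₀¹ t(1 - t) dt`, so criticality forces `D = 0`. -/
theorem isGeodesic_orbit_iff {X : Matrix (Fin 6) (Fin 6) ℝ} (hX : X ∈ mSpace) {x : ℝ}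
    (hx : x ≠ 1) : IsGeodesic x (orbit X) ↔ normalDefect X = 0 := by
  have hs := ((mem_mSpace_iff X).1 hX).1
  constructor
  · rintro ⟨-, -, h⟩
    have h1 := (h 0 1 one_pos _ (defectVariation_isVariation hX)).unique
      ((defectVariation_isVariation hX).hasDerivAt_energy hX x)
    simp only [variationField_defectVariation, Matrix.mul_smul, Matrix.trace_smul, smul_eq_mul,
      exp_mul_transpose_mul hs] at h1
    rw [intervalIntegral.integral_mul_const] at h1
    have h2 : ∫ t in (0 : ℝ)..1, t * (1 - t) = 1 / 6 := by
      simp only [mul_sub, mul_one, ← sq]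
      rw [intervalIntegral.integral_sub (by simp) (by simp)]
      norm_num
    rw [h2] at h1
    have h3 : ((normalDefect X)ᵀ * normalDefect X).trace = 0 := by
      refine mul_left_cancel₀ (sub_ne_zero.2 hx) ?_
      linear_combination (3 / 4) * h1
    rw [← Matrix.conjTranspose_eq_transpose_of_trivial] at h3
    exact Matrix.trace_conjTranspose_mul_self_eq_zero_iff.1 h3
  · intro h
    refine ⟨orbit_mem_stiefel hs, orbit_contDiff X, fun a b _ F hF => ?_⟩
    refine (hF.hasDerivAt_energy hX x).congr_deriv ?_
    simp [h]

/-! ### The defect in coordinates and the equigeodesic vectors. -/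

theorem mul_origin_apply {n : Type*} (M : Matrix n (Fin 6) ℝ) (i : n) (j : Fin 4) :
    (M * origin) i j = M i (j.castLE (by norm_num)) := by
  fin_cases j <;> simp [origin, Matrix.mul_apply, Fin.sum_univ_succ]

theorem tangentBlock_toMat (a : Coeff) :
    tangentBlock (toMat a) =
      !![0, a.a12, a.a13, a.a14;
        -a.a12, 0, a.a23, a.a24;
        -a.a13, -a.a23, 0, a.a34;
        -a.a14, -a.a24, -a.a34, 0] := by
  ext i j
  rw [tangentBlock]
  rw [mul_origin_apply, ← Matrix.transpose_apply (originᵀ * toMat a),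
    Matrix.transpose_mul, Matrix.transpose_transpose, mul_origin_apply, Matrix.transpose_apply]
  fin_cases i <;> fin_cases j <;> simp [toMat, Fin.castLE]

theorem normalDefect_toMat (a : Coeff) :
    normalDefect (toMat a) =
      !![0, 0, 0, 0; 0, 0, 0, 0; 0, 0, 0, 0; 0, 0, 0, 0;
        -a.a15, -a.a25, -a.a35, -a.a45;
        -a.a16, -a.a26, -a.a36, -a.a46] * tangentBlock (toMat a) := by
  rw [normalDefect]
  congr 1
  have h : toMat a * origin - origin * tangentBlock (toMat a)
      = (1 - origin * originᵀ) * (toMat a * origin) := by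
    simp only [tangentBlock, Matrix.sub_mul, Matrix.one_mul, Matrix.mul_assoc]
  rw [h, origin_mul_transpose]
  ext i j
  rw [Matrix.diagonal_mul, mul_origin_apply]
  fin_cases i <;> fin_cases j <;> simp [toMat, Fin.castLE]

/-- Two nonzero rows of `N` against four columns of `A` give the eight equations, up to sign. -/
theorem normalDefect_toMat_eq_zero_iff (a : Coeff) :
    normalDefect (toMat a) = 0 ↔ BilinearSystem a := by
  rw [normalDefect_toMat, tangentBlock_toMat, BilinearSystem]
  constructor
  · intro h
    have e := fun i j => congrFun (congrFun h i) j
    simp only [Matrix.mul_apply, Fin.sum_univ_four] at e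
    refine ⟨?_, ?_, ?_, ?_, ?_, ?_, ?_, ?_⟩
    · have := e 4 1; simp at this; linear_combination -this
    · have := e 5 1; simp at this; linear_combination -this
    · have := e 4 2; simp at this; linear_combination -this
    · have := e 5 2; simp at this; linear_combination -this
    · have := e 4 3; simp at this; linear_combination -this
    · have := e 5 3; simp at this; linear_combination -this
    · have := e 4 0; simp at this; linear_combination this
    · have := e 5 0; simp at this; linear_combination this
  · rintro ⟨h1, h2, h3, h4, h5, h6, h7, h8⟩
    ext i j
    rw [Matrix.mul_apply, Fin.sum_univ_four]
    fin_cases i <;> fin_cases j <;> simp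
    · linear_combination h7
    · linear_combination -h1
    · linear_combination -h3
    · linear_combination -h5
    · linear_combination h8
    · linear_combination -h2
    · linear_combination -h4
    · linear_combination -h6

theorem isGeodesic_orbit_iff_bilinearSystem {X : Matrix (Fin 6) (Fin 6) ℝ} (hX : X ∈ mSpace)
    {x : ℝ} (hx : x ≠ 1) : IsGeodesic x (orbit X) ↔ BilinearSystem (coeff X) := by
  rw [isGeodesic_orbit_iff hX hx, ← normalDefect_toMat_eq_zero_iff, toMat_coeff hX]

theorem bilinearSystem_iff_exists_mem_family (a : Coeff) :
    BilinearSystem a ↔ ∃ i, a ∈ family i :=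
  ⟨BilinearSystem.exists_mem_family, fun ⟨_, h⟩ => bilinearSystem_of_mem_family h⟩

theorem isJensenEquigeodesicVector_iff (X : Matrix (Fin 6) (Fin 6) ℝ) :
    IsJensenEquigeodesicVector X ↔ X ∈ mSpace ∧ X ≠ 0 ∧ ∃ i, coeff X ∈ family i := by
  constructor
  · rintro ⟨hX, h0, h⟩
    -- One metric is enough, since the criterion does not involve `x`; this root is visibly
    -- positive.
    have hx : IsEinstein ((4 + Real.sqrt 6) / 5) := isEinstein_iff.2 (Or.inl rfl)
    refine ⟨hX, h0, (bilinearSystem_iff_exists_mem_family _).1 ?_⟩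
    exact (isGeodesic_orbit_iff_bilinearSystem hX (ne_one_of_isEinstein hx)).1
      (h _ (by positivity) hx)
  · rintro ⟨hX, h0, h⟩
    refine ⟨hX, h0, fun x _ hx => ?_⟩
    exact (isGeodesic_orbit_iff_bilinearSystem hX (ne_one_of_isEinstein hx)).2
      ((bilinearSystem_iff_exists_mem_family _).2 h)

end StiefelV4R6

end

/-! ### Assembly of the equivalences. -/

theorem mainTheorem6 :
    -- the Jensen Einstein metrics
    (∀ x : ℝ, 0 < x →
      (IsEinstein x ↔ x = (4 + Real.sqrt 6) / 5 ∨ x = (4 - Real.sqrt 6) / 5)) ∧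
    -- geodesic vectors of each Jensen Einstein metric
    (∀ x : ℝ, 0 < x → IsEinstein x → ∀ X ∈ mSpace,
      (IsGeodesic x (orbit X) ↔ projM ⁅X, jensenOp x X⁆ = 0) ∧
      (IsGeodesic x (orbit X) ↔
        projM ⁅part 1 2 X, part 1 1 X⁆ + projM ⁅part 0 2 X, part 0 1 X⁆ = 0 ∧
        projM ⁅part 1 2 X, part 0 1 X⁆ = 0) ∧
      (IsGeodesic x (orbit X) ↔ BilinearSystem (coeff X)) ∧
      (IsGeodesic x (orbit X) ↔ ∃ i, coeff X ∈ family i)) ∧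
    -- the Jensen Einstein equigeodesic vectors form 42 classes
    (∀ X, IsJensenEquigeodesicVector X ↔ X ∈ mSpace ∧ X ≠ 0 ∧ ∃ i, coeff X ∈ family i) ∧
    Function.Injective family := by
  refine ⟨fun x _ => isEinstein_iff, fun x _ hx X hX => ?_, isJensenEquigeodesicVector_iff,
    family_injective⟩
  have h1 : x ≠ 1 := ne_one_of_isEinstein hx
  rw [isGeodesic_orbit_iff_bilinearSystem hX h1]
  refine ⟨?_, ?_, Iff.rfl, bilinearSystem_iff_exists_mem_family _⟩
  · rw [← projM_bracket_jensenOp_eq_zero_iff h1, toMat_coeff hX]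
  · rw [← bracket_parts_eq_zero_iff, toMat_coeff hX]
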